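/- Let $K$ be a field and $Q$ a finite quiver without oriented cycles. A representation of $Q$ means a finite-dimensional representation over $K$, and $R(Q)$ is the representation ring: the free abelian group on isomorphism classes of representations modulo all $[V\oplus W]-[V]-[W]$, with product induced by the pointwise tensor product. A quiver over $Q$ is a finite quiver $Q'$ with a morphism of quivers $f'\colon Q'\to Q$; morphisms of quivers over $Q$ are those commuting with the structure maps. The linearization $L(Q',f')$ is the pushforward $f'_*\mathbb 1_{Q'}$ of the identity representation: its space at a vertex $x$ has basis $\{e_y : f'(y)=x\}$, and an arrow $\alpha$ acts by $e_y\mapsto\sum_{\beta} e_{t(\beta)}$, the sum being over the arrows $\beta$ of $Q'$ with $f'(\beta)=\alpha$ and $s(\beta)=y$. For a subquiver $T\subseteq Q$: - if $T$ has a unique source $i$, let $P_T$ be the quiver over $Q$ whose vertices are the paths in $T$ starting at $i$, each lying over its end point, with one arrow $p\to p\alpha$ over $\alpha$ for each such path $p$ and each arrow $\alpha$ of $T$ starting at the end point of $p$; - if $T$ has a unique sink, let $I_T$ be the dual construction on the paths in $T$ ending at the sink; - if $T$ is connected (in particular nonempty), let $E_T$ be the inclusion $T\hookrightarrow Q$.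 Let $\mathrm{PIE}$ be the full subcategory of the category of quivers over $Q$ whose objects are all these $P_T$, $I_T$, $E_T$, where objects isomorphic over $Q$ are identified. **Theorem.** 1. $\mathrm{PIE}$ is an acyclic category (the only endomorphisms are identities, and only identities are invertible). Its objects are connected quivers, and their structure maps are wrappings, i.e. injective on each set of parallel arrows. The fiber product over $Q$ of two objects of $\mathrm{PIE}$ is a (possibly empty) disjoint union of objects of $\mathrm{PIE}$. For every object $x$ the representation $L(x)$ is indecomposable, and $L(x)\not\simeq L(y)$ for distinct objects $x\neq y$. 2. $L(P_T)$ is an indecomposable subprojective representation (its restriction to its support is projective), $L(I_T)$ is an indecomposable subinjective representation (its restriction to its support is injective), and $L(E_T)$ is an indecomposable idempotent representation (its restriction to its support is the identity representation), whenever these objects are defined. 3. Write $[x,y]$ for the number of morphisms $x\to y$ in $\mathrm{PIE}$. The matrix $([x,y])_{x,y}$ is invertible over $\mathbb Z$; its inverse $\mu$, the Möbius function of $\mathrm{PIE}$, satisfies $\mu(x,x)=1$, $\sum_z [x,z]\mu(z,x)=1$, and $\sum_z [x,z]\mu(z,y)=0$ for $x\ne y$. For each object $x$ let $\delta_x=\sum_z\mu(z,x)\,z$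 in the free abelian group on the objects of $\mathrm{PIE}$ and let $e_x=L(\delta_x)=\sum_z \mu(z,x)\,L(z)\in R(Q)$. Every $e_x$ is idempotent, and $r\mapsto (r e_x)_x$ is an isomorphism of rings $$R(Q)\;\cong\;\prod_{x\in \mathrm{PIE}_0}\langle e_x\rangle ,$$ where $\langle e_x\rangle$ is the principal ideal of $R(Q)$ generated by $e_x$. -/

import Mathlib

open CategoryTheory

open scoped TensorProduct

universe u

namespace QuiverRep

/-! ## Finite quivers -/

/-- A (finite) quiver `(Q₀, Q₁, s, t)`. -/
structure FinQuiver : Type (u + 1) where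
  V : Type u
  A : Type u
  s : A → V
  t : A → V
  finV : Finite V
  finA : Finite A

attribute [instance] FinQuiver.finV FinQuiver.finA

namespace FinQuiver

/-- Morphisms of quivers. -/
@[ext]
structure Hom (Q R : FinQuiver.{u}) : Type u where
  onV : Q.V → R.V
  onA : Q.A → R.A
  s_onA : ∀ a, R.s (onA a) = onV (Q.s a)
  t_onA : ∀ a, R.t (onA a) = onV (Q.t a)

/-- The identity morphism. -/
def Hom.id (Q : FinQuiver.{u}) : Hom Q Q := ⟨fun v => v, fun a => a, fun _ => rfl, fun _ => rfl⟩

/-- Composition of morphisms: first `f`, then `g`. -/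
def Hom.comp {Q R S : FinQuiver.{u}} (f : Hom Q R) (g : Hom R S) : Hom Q S where
  onV v := g.onV (f.onV v)
  onA a := g.onA (f.onA a)
  s_onA a := by rw [g.s_onA, f.s_onA]
  t_onA a := by rw [g.t_onA, f.t_onA]

/-- `Q.IsPath i l j`: the list of arrows `l` is a path from `i` to `j`
(the empty list is the trivial path). -/
inductive IsPath (Q : FinQuiver.{u}) (i : Q.V) : List Q.A → Q.V → Prop
  | nil : IsPath Q i [] i
  | snoc {l : List Q.A} (a : Q.A) : IsPath Q i l (Q.s a) → IsPath Q i (l ++ [a]) (Q.t a)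

/-- A quiver without oriented cycles. -/
class IsAcyclic (Q : FinQuiver.{u}) : Prop where
  eq_nil : ∀ (i : Q.V) (l : List Q.A), Q.IsPath i l i → l = []

/-- A connected quiver: nonempty, with connected underlying undirected graph. -/
def IsConnected (Q : FinQuiver.{u}) : Prop :=
  Nonempty Q.V ∧ ∀ v w : Q.V, Relation.EqvGen (fun x y => ∃ a, Q.s a = x ∧ Q.t a = y) v w

/-- `i` is a source (no arrow ends at `i`) and it is the only one. -/
def IsUniqueSource (Q : FinQuiver.{u}) (i : Q.V) : Prop :=
  ∀ v : Q.V, (∀ a, Q.t a ≠ v) ↔ v = i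

/-- `i` is a sink (no arrow starts at `i`) and it is the only one. -/
def IsUniqueSink (Q : FinQuiver.{u}) (i : Q.V) : Prop :=
  ∀ v : Q.V, (∀ a, Q.s a ≠ v) ↔ v = i

/-- The opposite quiver. -/
def op (Q : FinQuiver.{u}) : FinQuiver.{u} := ⟨Q.V, Q.A, Q.t, Q.s, Q.finV, Q.finA⟩

/-! Paths in acyclic quivers: there are finitely many of them. -/

theorem IsPath.append {Q : FinQuiver.{u}} {i j k : Q.V} {l m : List Q.A} (h : Q.IsPath i l j)
    (h2 : Q.IsPath j m k) : Q.IsPath i (l ++ m) k := by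
  induction h2 with
  | nil => simpa using h
  | snoc a _ ih => rw [← List.append_assoc]; exact IsPath.snoc a ih

theorem IsPath.op_reverse {Q : FinQuiver.{u}} {i j : Q.V} {l : List Q.A} (h : Q.IsPath i l j) :
    Q.op.IsPath j l.reverse i := by
  induction h with
  | nil => exact IsPath.nil
  | snoc a _ ih =>
    rw [List.reverse_append]
    exact IsPath.append (Q := Q.op) (IsPath.snoc (Q := Q.op) (l := []) a IsPath.nil) ih

instance (Q : FinQuiver.{u}) [hQ : Q.IsAcyclic] : Q.op.IsAcyclic where
  eq_nil i l h := by
    have h2 : Q.IsPath i l.reverse i := IsPath.op_reverse h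
    exact List.reverse_eq_nil_iff.1 (hQ.eq_nil i _ h2)

theorem IsPath.split {Q : FinQuiver.{u}} {i j : Q.V} {l : List Q.A} (h : Q.IsPath i l j)
    {a : Q.A} (ha : a ∈ l) : ∃ m, Q.IsPath (Q.s a) (a :: m) j := by
  induction h with
  | nil => simp at ha
  | snoc b _ ih =>
    rcases List.mem_append.1 ha with h1 | h1
    · obtain ⟨m, hm⟩ := ih h1
      exact ⟨m ++ [b], IsPath.snoc b hm⟩
    · obtain rfl : a = b := by simpa using h1
      exact ⟨[], IsPath.snoc (l := []) a IsPath.nil⟩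

theorem IsPath.nodup {Q : FinQuiver.{u}} [hQ : Q.IsAcyclic] {i j : Q.V} {l : List Q.A}
    (h : Q.IsPath i l j) : l.Nodup := by
  induction h with
  | nil => simp
  | snoc a hl ih =>
    rw [List.nodup_append]
    refine ⟨ih, by simp, ?_⟩
    rintro b hb c hc rfl
    obtain rfl : b = a := by simpa using hc
    obtain ⟨m, hm⟩ := hl.split hb
    simpa using hQ.eq_nil _ _ hm

theorem finite_paths (Q : FinQuiver.{u}) [Q.IsAcyclic] (i : Q.V) :
    Finite {p : List Q.A × Q.V // Q.IsPath i p.1 p.2} := by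
  classical
  let _ := Fintype.ofFinite Q.A
  have h : {l : List Q.A | l.Nodup}.Finite := by
    refine (List.finite_length_le Q.A (Fintype.card Q.A)).subset ?_
    intro l hl
    exact List.Nodup.length_le_card hl
  have : Finite {l : List Q.A // l.Nodup} := h
  refine Finite.of_injective
    (β := {l : List Q.A // l.Nodup} × Q.V) (fun p => (⟨p.1.1, p.2.nodup⟩, p.1.2)) ?_
  rintro ⟨⟨l, v⟩, hp⟩ ⟨⟨m, w⟩, hq⟩ h
  simp only [Prod.mk.injEq, Subtype.mk.injEq] at h
  obtain ⟨rfl, rfl⟩ := h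
  rfl

end FinQuiver

/-! ## Subquivers -/

/-- A subquiver: a set of vertices and a set of arrows between them. -/
@[ext]
structure Subquiver (Q : FinQuiver.{u}) : Type u where
  verts : Set Q.V
  arrows : Set Q.A
  s_mem : ∀ a ∈ arrows, Q.s a ∈ verts
  t_mem : ∀ a ∈ arrows, Q.t a ∈ verts

namespace Subquiver

variable {Q : FinQuiver.{u}}

/-- A subquiver, as a quiver. -/
def toFinQuiver (T : Subquiver Q) : FinQuiver.{u} where
  V := T.verts
  A := T.arrows
  s a := ⟨Q.s a.1, T.s_mem a.1 a.2⟩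
  t a := ⟨Q.t a.1, T.t_mem a.1 a.2⟩
  finV := inferInstance
  finA := inferInstance

/-- The inclusion `T → Q`. -/
def incl (T : Subquiver Q) : FinQuiver.Hom T.toFinQuiver Q :=
  ⟨Subtype.val, Subtype.val, fun _ => rfl, fun _ => rfl⟩

theorem isPath_map (T : Subquiver Q) {i j : T.toFinQuiver.V} {l : List T.toFinQuiver.A}
    (h : T.toFinQuiver.IsPath i l j) : Q.IsPath i.1 (l.map T.incl.onA) j.1 := by
  induction h with
  | nil => exact FinQuiver.IsPath.nil
  | snoc a _ ih =>
    rw [List.map_append]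
    exact FinQuiver.IsPath.snoc (T.incl.onA a) ih

instance (T : Subquiver Q) [hQ : Q.IsAcyclic] : T.toFinQuiver.IsAcyclic where
  eq_nil i l h := by simpa using hQ.eq_nil _ _ (T.isPath_map h)

end Subquiver

/-! ## The category of quivers over `Q` -/

/-- A quiver over `Q`: a quiver with a structure map to `Q`. -/
structure OverQ (Q : FinQuiver.{u}) : Type (u + 1) where
  quiv : FinQuiver.{u}
  str : FinQuiver.Hom quiv Q

namespace OverQ

variable {Q : FinQuiver.{u}}

/-- Morphisms of quivers over `Q`: those commuting with the structure maps. -/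
@[ext]
structure Hom (X Y : OverQ Q) : Type u where
  hom : FinQuiver.Hom X.quiv Y.quiv
  comm : hom.comp Y.str = X.str

instance : Category.{u} (OverQ Q) where
  Hom := Hom
  id X := ⟨FinQuiver.Hom.id X.quiv, rfl⟩
  comp f g := ⟨f.hom.comp g.hom, by rw [← f.comm, ← g.comm]; rfl⟩

/-- The fiber product of two quivers over `Q`. -/
def fiberProd (X Y : OverQ Q) : OverQ Q where
  quiv :=
    { V := {p : X.quiv.V × Y.quiv.V // X.str.onV p.1 = Y.str.onV p.2}
      A := {p : X.quiv.A × Y.quiv.A // X.str.onA p.1 = Y.str.onA p.2}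
      s := fun p => ⟨(X.quiv.s p.1.1, Y.quiv.s p.1.2), by
        rw [← X.str.s_onA, ← Y.str.s_onA, p.2]⟩
      t := fun p => ⟨(X.quiv.t p.1.1, Y.quiv.t p.1.2), by
        rw [← X.str.t_onA, ← Y.str.t_onA, p.2]⟩
      finV := inferInstance
      finA := inferInstance }
  str :=
    { onV := fun p => X.str.onV p.1.1
      onA := fun p => X.str.onA p.1.1
      s_onA := fun p => X.str.s_onA p.1.1
      t_onA := fun p => X.str.t_onA p.1.1 }

/-- The disjoint union of finitely many quivers over `Q`. -/
def disjointUnion {n : ℕ} (w : Fin n → OverQ Q) : OverQ Q where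
  quiv :=
    { V := Σ k, (w k).quiv.V
      A := Σ k, (w k).quiv.A
      s := fun a => ⟨a.1, (w a.1).quiv.s a.2⟩
      t := fun a => ⟨a.1, (w a.1).quiv.t a.2⟩
      finV := inferInstance
      finA := inferInstance }
  str :=
    { onV := fun v => (w v.1).str.onV v.2
      onA := fun a => (w a.1).str.onA a.2
      s_onA := fun a => (w a.1).str.s_onA a.2
      t_onA := fun a => (w a.1).str.t_onA a.2 }

/-- The structure map does not identify distinct parallel arrows. -/
def IsWrapping (X : OverQ Q) : Prop :=
  ∀ a b : X.quiv.A, X.quiv.s a = X.quiv.s b → X.quiv.t a = X.quiv.t b →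
    X.str.onA a = X.str.onA b → a = b

/-- View a quiver over `R` as a quiver over `Q`, along `f : R → Q`. -/
def along {R : FinQuiver.{u}} (X : OverQ R) (f : FinQuiver.Hom R Q) : OverQ Q :=
  ⟨X.quiv, X.str.comp f⟩

/-- Reverse all arrows of a quiver over the opposite of `Q`. -/
def unop (X : OverQ Q.op) : OverQ Q where
  quiv := X.quiv.op
  str := ⟨X.str.onV, X.str.onA, X.str.t_onA, X.str.s_onA⟩

end OverQ

/-! ## The objects `P_T`, `I_T`, `E_T` -/

/-- The quiver over `Q` whose vertices are the paths `p` of `Q` starting at `i`, lying over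
their end points, with one arrow `p → pα` over `α` for each path `p` and each arrow `α` of `Q`
starting at the end point of `p`. -/
def pathSpace (Q : FinQuiver.{u}) [Q.IsAcyclic] (i : Q.V) : OverQ Q where
  quiv :=
    { V := {p : List Q.A × Q.V // Q.IsPath i p.1 p.2}
      A := {x : {p : List Q.A × Q.V // Q.IsPath i p.1 p.2} × Q.A // x.1.1.2 = Q.s x.2}
      s := fun x => x.1.1
      t := fun x => ⟨(x.1.1.1.1 ++ [x.1.2], Q.t x.1.2),
        FinQuiver.IsPath.snoc x.1.2 (x.2 ▸ x.1.1.2)⟩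
      finV := Q.finite_paths i
      finA := by
        have := Q.finite_paths i
        infer_instance }
  str :=
    { onV := fun p => p.1.2
      onA := fun x => x.1.2
      s_onA := fun x => x.2.symm
      t_onA := fun _ => rfl }

section PIE

variable {Q : FinQuiver.{u}}

/-- `P_T`, to be used when `i` is the unique source of `T`. -/
def objP [Q.IsAcyclic] (T : Subquiver Q) (i : T.toFinQuiver.V) : OverQ Q :=
  (pathSpace T.toFinQuiver i).along T.incl

/-- `I_T`, to be used when `i` is the unique sink of `T`: the dual of `P_T`, so its vertices
are the paths in `T` ending at `i` (recorded backwards, as paths of the opposite quiver). -/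
def objI [Q.IsAcyclic] (T : Subquiver Q) (i : T.toFinQuiver.V) : OverQ Q :=
  (OverQ.unop (Q := T.toFinQuiver) (pathSpace T.toFinQuiver.op i)).along T.incl

/-- `E_T`: the inclusion of `T` into `Q`. -/
def objE (T : Subquiver Q) : OverQ Q := ⟨T.toFinQuiver, T.incl⟩

/-- The quivers `P_T` (`T` with a unique source), `I_T` (`T` with a unique sink) and
`E_T` (`T` connected) over `Q`. -/
inductive IsPIE (Q : FinQuiver.{u}) [Q.IsAcyclic] : OverQ Q → Prop
  | P (T : Subquiver Q) (i : T.toFinQuiver.V) (h : T.toFinQuiver.IsUniqueSource i) :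
      IsPIE Q (objP T i)
  | I (T : Subquiver Q) (i : T.toFinQuiver.V) (h : T.toFinQuiver.IsUniqueSink i) :
      IsPIE Q (objI T i)
  | E (T : Subquiver Q) (h : T.toFinQuiver.IsConnected) : IsPIE Q (objE T)

/-- The PIE category: the full subcategory of quivers over `Q` on the `P_T`, `I_T`, `E_T`,
where isomorphic quivers over `Q` count as one object. -/
abbrev PIE (Q : FinQuiver.{u}) [Q.IsAcyclic] : Type (u + 1) :=
  Skeleton (ObjectProperty.FullSubcategory (C := OverQ Q) (IsPIE Q))

/-- The inclusion of the PIE category into the category of quivers over `Q`. -/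
noncomputable abbrev PIE.incl (Q : FinQuiver.{u}) [Q.IsAcyclic] : PIE Q ⥤ OverQ Q :=
  fromSkeleton _ ⋙ ObjectProperty.ι (C := OverQ Q) (IsPIE Q)

instance (T : FinQuiver.{u}) : Finite (Subquiver T) :=
  Finite.of_injective (fun S : Subquiver T => (S.verts, S.arrows)) (by
    intro S S2 h
    simp only [Prod.mk.injEq] at h
    exact Subquiver.ext h.1 h.2)

instance PIE.finite (Q : FinQuiver.{u}) [Q.IsAcyclic] : Finite (PIE Q) := by
  have h : {X : OverQ Q | IsPIE Q X}.Finite := by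
    have h1 : (Set.range fun x : (Σ T : Subquiver Q, T.toFinQuiver.V) => objP x.1 x.2).Finite :=
      Set.finite_range _
    have h2 : (Set.range fun x : (Σ T : Subquiver Q, T.toFinQuiver.V) => objI x.1 x.2).Finite :=
      Set.finite_range _
    have h3 : (Set.range fun T : Subquiver Q => objE T).Finite := Set.finite_range _
    refine ((h1.union h2).union h3).subset ?_
    rintro X hX
    cases hX with
    | P T i h => exact Or.inl (Or.inl ⟨⟨T, i⟩, rfl⟩)
    | I T i h => exact Or.inl (Or.inr ⟨⟨T, i⟩, rfl⟩)
    | E T h => exact Or.inr ⟨T, rfl⟩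
  have : Finite {X : OverQ Q // IsPIE Q X} := h
  have : Finite (ObjectProperty.FullSubcategory (C := OverQ Q) (IsPIE Q)) :=
    Finite.of_injective (β := {X : OverQ Q // IsPIE Q X}) (fun X => ⟨X.obj, X.property⟩) (by
      rintro ⟨X, hX⟩ ⟨Y, hY⟩ h
      simp only [Subtype.mk.injEq] at h
      subst h
      rfl)
  exact Quotient.finite _

end PIE

/-! ## Representations -/

/-- A (finite-dimensional) representation of `Q` over `K`. -/
structure Rep (K : Type u) [Field K] (Q : FinQuiver.{u}) : Type (u + 1) where
  sp : Q.V → Type u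
  [acg : ∀ x, AddCommGroup (sp x)]
  [mod : ∀ x, Module K (sp x)]
  [fin : ∀ x, FiniteDimensional K (sp x)]
  map : ∀ a : Q.A, sp (Q.s a) →ₗ[K] sp (Q.t a)

attribute [instance] Rep.acg Rep.mod Rep.fin

namespace Rep

variable {K : Type u} [Field K] {Q : FinQuiver.{u}}

/-- Morphisms of representations. -/
structure Hom (V W : Rep K Q) : Type u where
  app : ∀ x, V.sp x →ₗ[K] W.sp x
  comm : ∀ a v, app (Q.t a) (V.map a v) = W.map a (app (Q.s a) v)

/-- Isomorphisms of representations. -/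
structure Iso (V W : Rep K Q) : Type u where
  app : ∀ x, V.sp x ≃ₗ[K] W.sp x
  comm : ∀ a v, app (Q.t a) (V.map a v) = W.map a (app (Q.s a) v)

/-- The identity isomorphism. -/
def Iso.refl (V : Rep K Q) : Iso V V := ⟨fun _ => LinearEquiv.refl K _, fun _ _ => rfl⟩

/-- The inverse isomorphism. -/
def Iso.symm {V W : Rep K Q} (e : Iso V W) : Iso W V :=
  ⟨fun x => (e.app x).symm, fun a w => by
    rw [LinearEquiv.symm_apply_eq, e.comm, LinearEquiv.apply_symm_apply]⟩

/-- Composition of isomorphisms. -/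
def Iso.trans {V W U : Rep K Q} (e : Iso V W) (f : Iso W U) : Iso V U :=
  ⟨fun x => (e.app x).trans (f.app x), fun a v => by
    simp only [LinearEquiv.trans_apply, e.comm, f.comm]⟩

/-- Isomorphism, as an equivalence relation. -/
instance setoid (K : Type u) [Field K] (Q : FinQuiver.{u}) : Setoid (Rep K Q) where
  r V W := Nonempty (Iso V W)
  iseqv := ⟨fun V => ⟨Iso.refl V⟩, fun ⟨e⟩ => ⟨e.symm⟩, fun ⟨e⟩ ⟨f⟩ => ⟨e.trans f⟩⟩

/-- The direct sum. -/
abbrev dsum (V W : Rep K Q) : Rep K Q where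
  sp x := V.sp x × W.sp x
  map a := (V.map a).prodMap (W.map a)

/-- The pointwise tensor product. -/
noncomputable abbrev tensor (V W : Rep K Q) : Rep K Q where
  sp x := V.sp x ⊗[K] W.sp x
  map a := TensorProduct.map (V.map a) (W.map a)

/-- The identity representation: `K` at each vertex, the identity map over each arrow. -/
abbrev one (K : Type u) [Field K] (Q : FinQuiver.{u}) : Rep K Q where
  sp _ := K
  map _ := LinearMap.id

/-- The zero representation. -/
def IsZero (V : Rep K Q) : Prop := ∀ x, Subsingleton (V.sp x)

/-- Indecomposable representations. -/
def IsIndecomposable (V : Rep K Q) : Prop :=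
  ¬ V.IsZero ∧ ∀ A B : Rep K Q, Nonempty (Iso V (A.dsum B)) → A.IsZero ∨ B.IsZero

/-- Projective representations: maps out of `V` lift along surjections. -/
def IsProjective (V : Rep K Q) : Prop :=
  ∀ (A B : Rep K Q) (g : Hom A B) (f : Hom V B), (∀ x, Function.Surjective (g.app x)) →
    ∃ h : Hom V A, ∀ x v, g.app x (h.app x v) = f.app x v

/-- Injective representations: maps into `V` extend along injections. -/
def IsInjective (V : Rep K Q) : Prop :=
  ∀ (A B : Rep K Q) (g : Hom A B) (f : Hom A V), (∀ x, Function.Injective (g.app x)) →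
    ∃ h : Hom B V, ∀ x v, h.app x (g.app x v) = f.app x v

/-- The support: vertices with nonzero space and arrows with nonzero map. -/
def support (V : Rep K Q) : Subquiver Q where
  verts := {x | Nontrivial (V.sp x)}
  arrows := {a | V.map a ≠ 0}
  s_mem a ha := by
    by_contra h
    have h2 : Subsingleton (V.sp (Q.s a)) := not_nontrivial_iff_subsingleton.1 h
    exact ha (LinearMap.ext fun v => by rw [Subsingleton.elim v 0, map_zero, map_zero])
  t_mem a ha := by
    by_contra h
    have h2 : Subsingleton (V.sp (Q.t a)) := not_nontrivial_iff_subsingleton.1 h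
    exact ha (LinearMap.ext fun v => Subsingleton.elim _ _)

/-- Restriction to a subquiver. -/
abbrev restrict (V : Rep K Q) (T : Subquiver Q) : Rep K T.toFinQuiver where
  sp x := V.sp x.1
  map a := V.map a.1

/-- The restriction of `V` to its support is projective. -/
def IsSubprojective (V : Rep K Q) : Prop := (V.restrict V.support).IsProjective

/-- The restriction of `V` to its support is injective. -/
def IsSubinjective (V : Rep K Q) : Prop := (V.restrict V.support).IsInjective

/-- `V` is (up to isomorphism) the identity representation of a subquiver, extended by zero;
that is, the restriction of `V` to its support is the identity representation. -/
def IsIdempotentRep (V : Rep K Q) : Prop :=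
  Nonempty (Iso (V.restrict V.support) (one K V.support.toFinQuiver))

open Classical in
/-- The pushforward of `V` along `f : R → Q`: the space at `x` is the direct sum of the `V_y`
over the vertices `y` above `x`, and the map of `a` is the sum of the maps of the arrows `b`
above `a`, each going from the summand of its start to the summand of its end. -/
noncomputable def pushforward {R : FinQuiver.{u}} (f : FinQuiver.Hom R Q) (V : Rep K R) :
    Rep K Q where
  sp x := (y : {y : R.V // f.onV y = x}) → V.sp y.1
  map a :=
    letI := Fintype.ofFinite {b : R.A // f.onA b = a}
    ∑ b : {b : R.A // f.onA b = a},
      (LinearMap.single K (fun y : {y : R.V // f.onV y = Q.t a} => V.sp y.1)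
        ⟨R.t b.1, by rw [← f.t_onA, b.2]⟩) ∘ₗ (V.map b.1) ∘ₗ
      (LinearMap.proj (φ := fun y : {y : R.V // f.onV y = Q.s a} => V.sp y.1)
        ⟨R.s b.1, by rw [← f.s_onA, b.2]⟩)

end Rep

/-- The linearization of a quiver over `Q`. -/
noncomputable def linearization (K : Type u) [Field K] {Q : FinQuiver.{u}} (X : OverQ Q) :
    Rep K Q :=
  Rep.pushforward X.str (Rep.one K X.quiv)

/-! ## The representation ring -/

section RepRing

variable (K : Type u) [Field K] (Q : FinQuiver.{u})

/-- Isomorphism classes of representations. -/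
def IsoClass : Type (u + 1) := Quotient (Rep.setoid K Q)

variable {K Q}

/-- The isomorphism class of a representation. -/
def Rep.cls (V : Rep K Q) : IsoClass K Q := Quotient.mk _ V

/-- Tensor product of isomorphisms. -/
noncomputable def Rep.Iso.tensor {V V2 W W2 : Rep K Q} (e : Iso V V2) (f : Iso W W2) :
    Iso (V.tensor W) (V2.tensor W2) where
  app x := TensorProduct.congr (e.app x) (f.app x)
  comm a v := by
    refine LinearMap.congr_fun (f := (TensorProduct.congr (e.app _) (f.app _)).toLinearMap ∘ₗ
      TensorProduct.map (V.map a) (W.map a))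
      (g := TensorProduct.map (V2.map a) (W2.map a) ∘ₗ
        (TensorProduct.congr (e.app _) (f.app _)).toLinearMap)
      (TensorProduct.ext' fun p q => ?_) v
    simp [e.comm, f.comm]

/-- Isomorphism classes form a commutative monoid under the tensor product. -/
noncomputable instance : CommMonoid (IsoClass K Q) where
  mul := Quotient.map₂ Rep.tensor fun _ _ ⟨e⟩ _ _ ⟨f⟩ => ⟨e.tensor f⟩
  one := (Rep.one K Q).cls
  mul_assoc := by
    rintro ⟨U⟩ ⟨V⟩ ⟨W⟩
    refine Quotient.sound ⟨⟨fun x => TensorProduct.assoc K _ _ _, ?_⟩⟩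
    intro a v
    exact LinearMap.congr_fun (f := (TensorProduct.assoc K _ _ _).toLinearMap ∘ₗ
      TensorProduct.map (TensorProduct.map (U.map a) (V.map a)) (W.map a))
      (g := TensorProduct.map (U.map a) (TensorProduct.map (V.map a) (W.map a)) ∘ₗ
        (TensorProduct.assoc K _ _ _).toLinearMap)
      (TensorProduct.ext_threefold fun _ _ _ => rfl) v
  mul_comm := by
    rintro ⟨U⟩ ⟨V⟩
    refine Quotient.sound ⟨⟨fun x => TensorProduct.comm K _ _, ?_⟩⟩
    intro a v
    exact LinearMap.congr_fun (f := (TensorProduct.comm K _ _).toLinearMap ∘ₗ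
      TensorProduct.map (U.map a) (V.map a))
      (g := TensorProduct.map (V.map a) (U.map a) ∘ₗ (TensorProduct.comm K _ _).toLinearMap)
      (TensorProduct.ext' fun _ _ => rfl) v
  one_mul := by
    rintro ⟨V⟩
    refine Quotient.sound ⟨⟨fun x => TensorProduct.lid K _, ?_⟩⟩
    intro a v
    exact LinearMap.congr_fun (f := (TensorProduct.lid K _).toLinearMap ∘ₗ
      TensorProduct.map (LinearMap.id (M := K)) (V.map a))
      (g := V.map a ∘ₗ (TensorProduct.lid K _).toLinearMap)
      (TensorProduct.ext' fun p q => by simp) v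
  mul_one := by
    rintro ⟨V⟩
    refine Quotient.sound ⟨⟨fun x => TensorProduct.rid K _, ?_⟩⟩
    intro a v
    exact LinearMap.congr_fun (f := (TensorProduct.rid K _).toLinearMap ∘ₗ
      TensorProduct.map (V.map a) (LinearMap.id (M := K)))
      (g := V.map a ∘ₗ (TensorProduct.rid K _).toLinearMap)
      (TensorProduct.ext' fun p q => by simp) v

variable (K Q)

/-- The elements `[V ⊕ W] - [V] - [W]` of the free abelian group on isomorphism classes. -/
def relations : Set (FreeAbelianGroup (IsoClass K Q)) :=
  {r | ∃ V W : Rep K Q, r = FreeAbelianGroup.of (V.dsum W).cls - FreeAbelianGroup.of V.cls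
    - FreeAbelianGroup.of W.cls}

variable {K Q}

theorem tensor_dsum_cls (U V W : Rep K Q) :
    U.cls * (V.dsum W).cls = ((U.tensor V).dsum (U.tensor W)).cls := by
  refine Quotient.sound ⟨⟨fun x => TensorProduct.prodRight K K _ _ _, ?_⟩⟩
  intro a v
  refine LinearMap.congr_fun (f := (TensorProduct.prodRight K K _ _ _).toLinearMap ∘ₗ
      TensorProduct.map (U.map a) ((V.map a).prodMap (W.map a)))
      (g := ((TensorProduct.map (U.map a) (V.map a)).prodMap
        (TensorProduct.map (U.map a) (W.map a))) ∘ₗ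
        (TensorProduct.prodRight K K _ _ _).toLinearMap)
      (TensorProduct.ext' fun p q => ?_) v
  simp

theorem mul_mem_relations (c r : FreeAbelianGroup (IsoClass K Q))
    (hr : r ∈ AddSubgroup.closure (relations K Q)) :
    c * r ∈ AddSubgroup.closure (relations K Q) := by
  induction c using FreeAbelianGroup.induction_on with
  | zero => simp
  | of c =>
    induction hr using AddSubgroup.closure_induction with
    | mem r hr =>
      obtain ⟨V, W, rfl⟩ := hr
      obtain ⟨U⟩ := c
      refine AddSubgroup.subset_closure ⟨U.tensor V, U.tensor W, ?_⟩
      change FreeAbelianGroup.of U.cls * _ = _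
      rw [← tensor_dsum_cls, mul_sub, mul_sub, FreeAbelianGroup.of_mul_of,
        FreeAbelianGroup.of_mul_of, FreeAbelianGroup.of_mul_of]
      rfl
    | zero => simp
    | add x y _ _ hx hy => rw [mul_add]; exact add_mem hx hy
    | neg x _ hx => rw [mul_neg]; exact neg_mem hx
  | neg c h => rw [neg_mul]; exact neg_mem h
  | add c d hc hd => rw [add_mul]; exact add_mem hc hd

variable (K Q)

/-- The subgroup generated by the relations `[V ⊕ W] - [V] - [W]`; it is an ideal. -/
noncomputable def relIdeal : Ideal (FreeAbelianGroup (IsoClass K Q)) where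
  toAddSubmonoid := (AddSubgroup.closure (relations K Q)).toAddSubmonoid
  smul_mem' c r hr := mul_mem_relations c r hr

/-- The representation ring `R(Q)`: the free abelian group on isomorphism classes of
representations, with product induced by the tensor product, modulo the subgroup generated by
all `[V ⊕ W] - [V] - [W]`. -/
abbrev RepRing : Type (u + 1) := FreeAbelianGroup (IsoClass K Q) ⧸ relIdeal K Q

variable {K Q}

/-- The class of a representation in the representation ring. -/
noncomputable def Rep.toRing (V : Rep K Q) : RepRing K Q :=
  Ideal.Quotient.mk (relIdeal K Q) (FreeAbelianGroup.of V.cls)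

end RepRing

/-! ## Acyclic categories and Möbius functions -/

section Mobius

universe v w

/-- The only endomorphisms are identities, and only identities are invertible. -/
structure IsAcyclicCategory (C : Type w) [Category.{v} C] : Prop where
  endo : ∀ (x : C) (f : x ⟶ x), f = 𝟙 x
  iso : ∀ (x y : C) (f : x ⟶ y), IsIso f → ∃ h : x = y, f = eqToHom h

/-- The Hom matrix: the entry at `(x, y)` is the number of morphisms from `x` to `y`. -/
noncomputable def homMatrix (C : Type w) [Category.{v} C] : Matrix C C ℤ :=
  fun x y => (Nat.card (x ⟶ y) : ℤ)

open Classical in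
/-- The Möbius function of a finite acyclic category: the inverse of the Hom matrix. -/
noncomputable def mobius (C : Type w) [Category.{v} C] [Finite C] : Matrix C C ℤ :=
  letI := Fintype.ofFinite C
  (homMatrix C)⁻¹

/-- The element `δ_x = ∑ z, μ(z, x) z` of the free abelian group on the objects. -/
noncomputable def delta {C : Type w} [Category.{v} C] [Finite C] (x : C) : C →₀ ℤ :=
  Finsupp.equivFunOnFinite.symm fun z => mobius C z x

end Mobius

/-- The hypotheses on a full subcategory `F : C ⥤ OverQ Q` of quivers over `Q`:
it is acyclic, its objects are connected and wrappings, it is closed under fiber products (the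
fiber product of two objects is a disjoint union of objects), and its objects have indecomposable
and pairwise non-isomorphic linearizations. -/
structure MainHypotheses (K : Type u) [Field K] {Q : FinQuiver.{u}} {C : Type (u + 1)}
    [Category.{u} C] (F : C ⥤ OverQ Q) : Prop where
  full : F.Full
  faithful : F.Faithful
  acyclic : IsAcyclicCategory C
  connected : ∀ x, (F.obj x).quiv.IsConnected
  wrapping : ∀ x, (F.obj x).IsWrapping
  fiberProd : ∀ x y, ∃ (n : ℕ) (w : Fin n → C),
    Nonempty ((F.obj x).fiberProd (F.obj y) ≅ OverQ.disjointUnion fun k => F.obj (w k))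
  indecomposable : ∀ x, (linearization K (F.obj x)).IsIndecomposable
  distinct : ∀ x y, x ≠ y →
    ¬ Nonempty (Rep.Iso (linearization K (F.obj x)) (linearization K (F.obj y)))

/-- The linearization map `L`, extended by linearity to the free abelian group on the objects
of the PIE category. -/
noncomputable def linMap (K : Type u) [Field K] (Q : FinQuiver.{u}) [Q.IsAcyclic] :
    (PIE Q →₀ ℤ) →ₗ[ℤ] RepRing K Q :=
  Finsupp.linearCombination ℤ fun x => (linearization K ((PIE.incl Q).obj x)).toRing

/-- The idempotent `e_x = L(δ_x)`. -/
noncomputable def pieIdem (K : Type u) [Field K] {Q : FinQuiver.{u}} [Q.IsAcyclic] (x : PIE Q) :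
    RepRing K Q :=
  linMap K Q (delta x)

end QuiverRep

/-! Up to isomorphism, the three kinds of objects are characterized by local conditions on a
connected quiver `X` over `Q`. `PLike`: at most one arrow ends at each vertex, and every arrow of
the image lifts uniquely once its start is lifted. As `Q` has no oriented cycles, such an `X` is a
tree with a root (`exists_root`), and the root is alone in its fiber (`eq_root`). `ILike` is the
dual condition, and `ELike` says that the structure map is injective.

These conditions behave well under fiber products and passage to components: P with P or E gives
trees, I with I or E gives the dual, E with E stays embedded. A component of a product of P and I
branches in neither direction, so it is an embedded path, of kind E (`PIELike.fiberProd_component`).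

On the linear side, all endomorphisms of the linearization of an object are scalars, which gives
indecomposability. For P an endomorphism is determined at the root, for I at the sink, and for E the
scalars at the vertices agree along arrows. The linearization remembers the image (its support) and
the sizes of the fibers (its dimensions). The image determines an object within its kind, and
objects of different kinds with isomorphic linearizations have trivial fibers, hence are both of
kind E (`PIELike.nonempty_iso`).

The ring isomorphism is Burnside's argument with tables of marks. The mark of an element at `z`
counts morphisms from `z`. It is multiplicative on fiber products by their universal property, and
additive on disjoint unions because `z` is connected. Linearization turns the same operations into
tensor products and direct sums. The Hom matrix is unitriangular when objects are ordered by height,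
so marks separate elements, and by the definition of the Möbius function the marks of `delta x` form
the indicator function of `x`. Hence the elements `pieIdem K x` are orthogonal idempotents. They sum
to the class of `Q` over itself, which is the unit, and a complete family of orthogonal idempotents
splits the ring. -/

namespace QuiverRep

/-! ## Reachability in acyclic quivers -/

namespace FinQuiver

/-- There is an arrow from `x` to `y`. -/
def Adj (Q : FinQuiver.{u}) (x y : Q.V) : Prop := ∃ a, Q.s a = x ∧ Q.t a = y

theorem adj (Q : FinQuiver.{u}) (a : Q.A) : Q.Adj (Q.s a) (Q.t a) := ⟨a, rfl, rfl⟩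

theorem Hom.adj {Q R : FinQuiver.{u}} (f : Hom Q R) {x y : Q.V} (h : Q.Adj x y) :
    R.Adj (f.onV x) (f.onV y) := by
  obtain ⟨a, rfl, rfl⟩ := h
  exact ⟨f.onA a, f.s_onA a, f.t_onA a⟩

theorem exists_isPath_of_transGen {Q : FinQuiver.{u}} {x y : Q.V}
    (h : Relation.TransGen Q.Adj x y) : ∃ l, l ≠ [] ∧ Q.IsPath x l y := by
  induction h with
  | single h =>
    obtain ⟨a, rfl, rfl⟩ := h
    exact ⟨[a], by simp, IsPath.snoc (l := []) a IsPath.nil⟩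
  | tail _ h ih =>
    obtain ⟨a, rfl, rfl⟩ := h
    obtain ⟨l, _, hl⟩ := ih
    exact ⟨l ++ [a], by simp, hl.snoc a⟩

theorem not_transGen_self (Q : FinQuiver.{u}) [hQ : Q.IsAcyclic] (x : Q.V) :
    ¬ Relation.TransGen Q.Adj x x := by
  intro h
  obtain ⟨l, hl, h⟩ := exists_isPath_of_transGen h
  exact hl (hQ.eq_nil _ _ h)

/-- A quiver mapping to an acyclic quiver is acyclic. -/
theorem Hom.not_transGen_self {Q R : FinQuiver.{u}} [R.IsAcyclic] (f : Hom Q R) (x : Q.V) :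
    ¬ Relation.TransGen Q.Adj x x := fun h =>
  R.not_transGen_self _ (h.lift f.onV fun _ _ => f.adj)

/-- A nontrivial path between two vertices of one fiber would map to an oriented cycle in `R`. This
is how acyclicity of the base forces vertices to coincide. -/
theorem Hom.eq_of_reflTransGen {Q R : FinQuiver.{u}} [R.IsAcyclic] (f : Hom Q R) {x y : Q.V}
    (h : Relation.ReflTransGen Q.Adj x y) (hf : f.onV x = f.onV y) : x = y := by
  rcases Relation.reflTransGen_iff_eq_or_transGen.1 h with h | h
  · exact h.symm
  · have := h.lift f.onV fun _ _ => f.adj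
    rw [Function.onFun, hf] at this
    exact (R.not_transGen_self _ this).elim

/-- Without cycles, reachability is a strict order on a finite set. This supports minimal vertices
and recursion along arrows. -/
theorem Hom.wellFounded {Q R : FinQuiver.{u}} [R.IsAcyclic] (f : Hom Q R) :
    WellFounded Q.Adj := by
  have : Std.Irrefl (Relation.TransGen Q.Adj) := ⟨f.not_transGen_self⟩
  exact Subrelation.wf (fun h => Relation.TransGen.single h)
    (Finite.wellFounded_of_trans_of_irrefl (Relation.TransGen Q.Adj))

theorem isConnected_of_reachable {Q : FinQuiver.{u}} {r : Q.V}
    (h : ∀ y, Relation.ReflTransGen Q.Adj r y) : Q.IsConnected := by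
  refine ⟨⟨r⟩, fun v w => ?_⟩
  have key : ∀ y, Relation.EqvGen Q.Adj r y := by
    intro y
    induction h y with
    | refl => exact .refl _
    | tail _ h ih => exact ih.trans _ _ _ (.rel _ _ h)
  exact ((key v).symm _ _).trans _ _ _ (key w)

theorem op_adj {Q : FinQuiver.{u}} {x y : Q.V} : Q.op.Adj x y ↔ Q.Adj y x :=
  ⟨fun ⟨a, h, h2⟩ => ⟨a, h2, h⟩, fun ⟨a, h, h2⟩ => ⟨a, h2, h⟩⟩

/-- The working form of connectedness: the truth value of `P` is constant along arrows, hence on the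
whole quiver. -/
theorem IsConnected.induction {Q : FinQuiver.{u}} (hQ : Q.IsConnected) {P : Q.V → Prop} {r : Q.V}
    (hr : P r) (h : ∀ a, P (Q.s a) ↔ P (Q.t a)) (y : Q.V) : P y := by
  have : ∀ x y, Relation.EqvGen (fun x y => ∃ a, Q.s a = x ∧ Q.t a = y) x y → (P x ↔ P y) := by
    intro x y hxy
    induction hxy with
    | rel _ _ h2 => obtain ⟨a, rfl, rfl⟩ := h2; exact h a
    | refl => rfl
    | symm _ _ _ ih => exact ih.symm
    | trans _ _ _ _ _ ih ih2 => exact ih.trans ih2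
  exact (this r y (hQ.2 r y)).1 hr

theorem IsConnected.op {Q : FinQuiver.{u}} (hQ : Q.IsConnected) : Q.op.IsConnected := by
  obtain ⟨r⟩ := hQ.1
  refine ⟨⟨r⟩, ?_⟩
  have key : ∀ y, Relation.EqvGen Q.op.Adj r y := fun y =>
    hQ.induction (P := fun y => Relation.EqvGen Q.op.Adj r y) (.refl r) (fun a =>
      ⟨fun h => h.trans _ _ _ (.symm _ _ (.rel _ _ (Q.op.adj a))),
        fun h => h.trans _ _ _ (.rel _ _ (Q.op.adj a))⟩) y
  exact fun v w => ((key v).symm _ _).trans _ _ _ (key w)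

end FinQuiver

/-! ## Lifting properties of quivers over `Q` -/

namespace OverQ

variable {Q : FinQuiver.{u}}

/-- At most one arrow ends at each vertex. -/
def InUnique (X : OverQ Q) : Prop := ∀ a b, X.quiv.t a = X.quiv.t b → a = b

/-- At most one arrow starts at each vertex. -/
def OutUnique (X : OverQ Q) : Prop := ∀ a b, X.quiv.s a = X.quiv.s b → a = b

/-- The structure map is injective on the arrows ending at each vertex. -/
def InInj (X : OverQ Q) : Prop :=
  ∀ a b, X.quiv.t a = X.quiv.t b → X.str.onA a = X.str.onA b → a = b

/-- The structure map is injective on the arrows starting at each vertex. -/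
def OutInj (X : OverQ Q) : Prop :=
  ∀ a b, X.quiv.s a = X.quiv.s b → X.str.onA a = X.str.onA b → a = b

/-- The arrows of `X` lie over `S`, and the arrows in `S` lift to `X` once the start is lifted. -/
def OutLift (X : OverQ Q) (S : Set Q.A) : Prop :=
  (∀ a, X.str.onA a ∈ S) ∧
    ∀ v, ∀ α ∈ S, Q.s α = X.str.onV v → ∃ a, X.quiv.s a = v ∧ X.str.onA a = α

/-- The arrows of `X` lie over `S`, and the arrows in `S` lift to `X` once the end is lifted. -/
def InLift (X : OverQ Q) (S : Set Q.A) : Prop :=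
  (∀ a, X.str.onA a ∈ S) ∧
    ∀ v, ∀ α ∈ S, Q.t α = X.str.onV v → ∃ a, X.quiv.t a = v ∧ X.str.onA a = α

theorem InUnique.inInj {X : OverQ Q} (h : X.InUnique) : X.InInj := fun a b hab _ => h a b hab

theorem OutUnique.outInj {X : OverQ Q} (h : X.OutUnique) : X.OutInj := fun a b hab _ => h a b hab

theorem OutInj.isWrapping {X : OverQ Q} (h : X.OutInj) : X.IsWrapping :=
  fun a b hs _ hf => h a b hs hf

/-- The lifting set may exceed the image: a component of a fiber product comes with an intersection
of two images, of which it may meet only a part. Shrinking to the image is harmless. -/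
theorem OutLift.range {X : OverQ Q} {S : Set Q.A} (h : X.OutLift S) :
    X.OutLift (Set.range X.str.onA) := by
  refine ⟨fun a => ⟨a, rfl⟩, ?_⟩
  rintro v _ ⟨b, rfl⟩ hv
  exact h.2 v _ (h.1 b) hv

theorem InLift.range {X : OverQ Q} {S : Set Q.A} (h : X.InLift S) :
    X.InLift (Set.range X.str.onA) := by
  refine ⟨fun a => ⟨a, rfl⟩, ?_⟩
  rintro v _ ⟨b, rfl⟩ hv
  exact h.2 v _ (h.1 b) hv

/-- The image of the structure map. -/
def image (X : OverQ Q) : Subquiver Q where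
  verts := Set.range X.str.onV
  arrows := Set.range X.str.onA
  s_mem := by rintro _ ⟨a, rfl⟩; exact ⟨_, (X.str.s_onA a).symm⟩
  t_mem := by rintro _ ⟨a, rfl⟩; exact ⟨_, (X.str.t_onA a).symm⟩

/-- The properties characterizing the objects `P_T`. -/
structure PLike (X : OverQ Q) : Prop where
  connected : X.quiv.IsConnected
  inUnique : X.InUnique
  outInj : X.OutInj
  outLift : X.OutLift (Set.range X.str.onA)

/-- The properties characterizing the objects `I_T`. -/
structure ILike (X : OverQ Q) : Prop where
  connected : X.quiv.IsConnected
  outUnique : X.OutUnique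
  inInj : X.InInj
  inLift : X.InLift (Set.range X.str.onA)

/-- The properties characterizing the objects `E_T`. -/
structure ELike (X : OverQ Q) : Prop where
  connected : X.quiv.IsConnected
  injV : Function.Injective X.str.onV
  injA : Function.Injective X.str.onA

theorem ELike.inInj {X : OverQ Q} (h : X.ELike) : X.InInj := fun _ _ _ hf => h.injA hf

theorem ELike.outInj {X : OverQ Q} (h : X.ELike) : X.OutInj := fun _ _ _ hf => h.injA hf

theorem ELike.outLift {X : OverQ Q} (h : X.ELike) : X.OutLift (Set.range X.str.onA) := by
  refine ⟨fun a => ⟨a, rfl⟩, ?_⟩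
  rintro v _ ⟨b, rfl⟩ hv
  exact ⟨b, h.injV (by rw [← hv, X.str.s_onA]), rfl⟩

theorem ELike.inLift {X : OverQ Q} (h : X.ELike) : X.InLift (Set.range X.str.onA) := by
  refine ⟨fun a => ⟨a, rfl⟩, ?_⟩
  rintro v _ ⟨b, rfl⟩ hv
  exact ⟨b, h.injV (by rw [← hv, X.str.t_onA]), rfl⟩

/-- Reverse all arrows. -/
def op (X : OverQ Q) : OverQ Q.op := OverQ.unop (Q := Q.op) X

theorem ILike.op {X : OverQ Q} (h : X.ILike) : X.op.PLike :=
  ⟨h.connected.op, h.outUnique, h.inInj, h.inLift⟩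

theorem ILike.unop {X : OverQ Q.op} (h : X.PLike) : X.unop.ILike :=
  ⟨h.connected.op, h.inUnique, h.outInj, h.outLift⟩

/-- A morphism of quivers over `Q` which is bijective on vertices and arrows is invertible. -/
theorem nonempty_iso_of_bijective {X Y : OverQ Q} (f : X ⟶ Y)
    (hV : Function.Bijective f.hom.onV) (hA : Function.Bijective f.hom.onA) :
    Nonempty (X ≅ Y) := by
  let eV := Equiv.ofBijective _ hV
  let eA := Equiv.ofBijective _ hA
  have h1 : ∀ v, eV.symm (f.hom.onV v) = v := eV.symm_apply_apply
  have h2 : ∀ v, f.hom.onV (eV.symm v) = v := eV.apply_symm_apply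
  have h3 : ∀ v, eA.symm (f.hom.onA v) = v := eA.symm_apply_apply
  have h4 : ∀ v, f.hom.onA (eA.symm v) = v := eA.apply_symm_apply
  let g : FinQuiver.Hom Y.quiv X.quiv :=
    { onV := eV.symm
      onA := eA.symm
      s_onA := fun a => by rw [Equiv.eq_symm_apply]; change f.hom.onV _ = _; rw [← f.hom.s_onA, h4]
      t_onA := fun a => by rw [Equiv.eq_symm_apply]; change f.hom.onV _ = _; rw [← f.hom.t_onA, h4] }
  have hg : g.comp X.str = Y.str := by
    rw [← f.comm]
    ext v
    · change Y.str.onV (f.hom.onV (eV.symm v)) = _; rw [h2]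
    · change Y.str.onA (f.hom.onA (eA.symm v)) = _; rw [h4]
  refine ⟨⟨f, ⟨g, hg⟩, ?_, ?_⟩⟩
  · apply OverQ.Hom.ext; apply FinQuiver.Hom.ext
    · funext v; exact h1 v
    · funext v; exact h3 v
  · apply OverQ.Hom.ext; apply FinQuiver.Hom.ext
    · funext v; exact h2 v
    · funext v; exact h4 v

theorem hom_onV {X Y : OverQ Q} (f : X ⟶ Y) (v : X.quiv.V) :
    Y.str.onV (f.hom.onV v) = X.str.onV v := by rw [← f.comm]; rfl

theorem hom_onA {X Y : OverQ Q} (f : X ⟶ Y) (v : X.quiv.A) :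
    Y.str.onA (f.hom.onA v) = X.str.onA v := by rw [← f.comm]; rfl

theorem nonempty_iso_unop {X Y : OverQ Q.op} (h : Nonempty (X ≅ Y)) :
    Nonempty (X.unop ≅ Y.unop) := by
  obtain ⟨e⟩ := h
  have key : ∀ {X Y : OverQ Q.op} (f : X ⟶ Y), ∃ g : X.unop ⟶ Y.unop,
      g.hom.onV = f.hom.onV ∧ g.hom.onA = f.hom.onA := by
    intro X Y f
    refine ⟨⟨⟨f.hom.onV, f.hom.onA, f.hom.t_onA, f.hom.s_onA⟩, ?_⟩, rfl, rfl⟩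
    apply FinQuiver.Hom.ext
    · funext v; exact hom_onV f v
    · funext v; exact hom_onA f v
  obtain ⟨g, h1, h2⟩ := key e.hom
  have hi : ∀ x, e.inv.hom.onV (e.hom.hom.onV x) = x := fun x =>
    congrArg (fun f : X ⟶ X => f.hom.onV x) e.hom_inv_id
  have hi2 : ∀ x, e.hom.hom.onV (e.inv.hom.onV x) = x := fun x =>
    congrArg (fun f : Y ⟶ Y => f.hom.onV x) e.inv_hom_id
  have hj : ∀ x, e.inv.hom.onA (e.hom.hom.onA x) = x := fun x =>
    congrArg (fun f : X ⟶ X => f.hom.onA x) e.hom_inv_id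
  have hj2 : ∀ x, e.hom.hom.onA (e.inv.hom.onA x) = x := fun x =>
    congrArg (fun f : Y ⟶ Y => f.hom.onA x) e.inv_hom_id
  refine nonempty_iso_of_bijective g ?_ ?_
  · rw [h1]; exact ⟨Function.LeftInverse.injective hi, Function.RightInverse.surjective hi2⟩
  · rw [h2]; exact ⟨Function.LeftInverse.injective hj, Function.RightInverse.surjective hj2⟩

/-! ### Rooted trees -/

/-- A minimal vertex serves as root. The vertices reachable from it are also closed under going
backwards, since the last arrow of a path to `t a` can only be `a`. -/
theorem exists_root {X : OverQ Q} [Q.IsAcyclic] (hc : X.quiv.IsConnected) (hX : X.InUnique) :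
    ∃ r, ∀ y, Relation.ReflTransGen X.quiv.Adj r y := by
  obtain ⟨r, -, hr⟩ := X.str.wellFounded.has_min Set.univ
    ⟨hc.1.some, trivial⟩
  refine ⟨r, fun y => hc.induction (P := fun y => Relation.ReflTransGen X.quiv.Adj r y)
    .refl (fun a => ⟨fun h => h.tail (X.quiv.adj a), fun h => ?_⟩) y⟩
  rcases h.cases_tail with h | ⟨c, h, b, rfl, hb⟩
  · exact (hr _ trivial (h ▸ X.quiv.adj a)).elim
  · rwa [hX a b hb.symm]

theorem no_arrow_to_root {X : OverQ Q} [Q.IsAcyclic] {r : X.quiv.V}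
    (hr : ∀ y, Relation.ReflTransGen X.quiv.Adj r y) (a : X.quiv.A) : X.quiv.t a ≠ r := by
  intro h
  exact X.str.not_transGen_self r (Relation.TransGen.tail' (hr (X.quiv.s a)) (h ▸ X.quiv.adj a))

/-- The root is alone in its fiber. This rigidity makes endomorphisms of trees trivial and the space
of the linearization at the root's vertex one-dimensional. -/
theorem eq_root {X : OverQ Q} [Q.IsAcyclic] {r y : X.quiv.V}
    (hr : ∀ y, Relation.ReflTransGen X.quiv.Adj r y) (hy : X.str.onV y = X.str.onV r) : y = r :=
  (X.str.eq_of_reflTransGen (hr y) hy.symm).symm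

/-- Recursion along a rooted tree. -/
theorem exists_section {X : OverQ Q} [Q.IsAcyclic] (hX : X.InUnique) {r : X.quiv.V}
    (hr : ∀ y, Relation.ReflTransGen X.quiv.Adj r y) {N : X.quiv.V → Type*} (w : N r)
    (step : ∀ b, N (X.quiv.s b) → N (X.quiv.t b)) :
    ∃ c : ∀ y, N y, c r = w ∧ ∀ b, c (X.quiv.t b) = step b (c (X.quiv.s b)) := by
  classical
  have h0 : ∀ y, (¬ ∃ b, X.quiv.t b = y) → r = y := by
    intro y hy
    rcases (hr y).cases_tail with h | ⟨c, h, b, hb, hb2⟩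
    · exact h.symm
    · exact (hy ⟨b, hb2⟩).elim
  -- A vertex at which an arrow ends takes the `step` of a chosen such arrow; by `h0` any other
  -- vertex is the root. The transports only adjust the type.
  let F : ∀ y, (∀ x, X.quiv.Adj x y → N x) → N y := fun y ih =>
    if h : ∃ b, X.quiv.t b = y then
      h.choose_spec ▸ step h.choose (ih _ (by
        have := h.choose_spec
        exact ⟨h.choose, rfl, this⟩))
    else h0 y h ▸ w
  have hF := X.str.wellFounded.fix_eq F
  refine ⟨X.str.wellFounded.fix F, ?_, ?_⟩
  · rw [hF]
    have : ¬ ∃ b, X.quiv.t b = r := fun ⟨b, hb⟩ => no_arrow_to_root hr b hb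
    simp only [F, dif_neg this]
  · intro b
    rw [hF]
    have hb : ∃ b', X.quiv.t b' = X.quiv.t b := ⟨b, rfl⟩
    simp only [F, dif_pos hb]
    -- The arrow chosen inside `F` need not be `b` by definition, but it is by in-uniqueness, and
    -- then the transport is trivial.
    have : ∀ b' (h' : X.quiv.t b' = X.quiv.t b), (h' ▸ step b' (X.str.wellFounded.fix F _) :
        N (X.quiv.t b)) = step b (X.str.wellFounded.fix F (X.quiv.s b)) := by
      intro b' h'
      obtain rfl := hX _ _ h'
      rfl
    exact this _ _

theorem tree_induction {X : OverQ Q} {r : X.quiv.V}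
    (hr : ∀ y, Relation.ReflTransGen X.quiv.Adj r y) {P : X.quiv.V → Prop} (h0 : P r)
    (h : ∀ b, P (X.quiv.s b) → P (X.quiv.t b)) (y : X.quiv.V) : P y := by
  induction hr y with
  | refl => exact h0
  | tail _ h2 ih => obtain ⟨b, rfl, rfl⟩ := h2; exact h b ih

/-- Rooted trees with the same liftable arrows and roots over the same vertex are isomorphic. -/
theorem nonempty_iso_of_trees {X Y : OverQ Q} [Q.IsAcyclic] {S : Set Q.A}
    (hX : X.InUnique) (hX2 : X.OutInj) (hX3 : X.OutLift S) {r : X.quiv.V}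
    (hr : ∀ y, Relation.ReflTransGen X.quiv.Adj r y)
    (hY : Y.InUnique) (hY2 : Y.OutInj) (hY3 : Y.OutLift S) {r' : Y.quiv.V}
    (hr' : ∀ y, Relation.ReflTransGen Y.quiv.Adj r' y)
    (h : X.str.onV r = Y.str.onV r') : Nonempty (X ≅ Y) := by
  -- Points of `Y` are kept together with the vertex of `Q` below them, so that the recursion yields
  -- a map over `Q`.
  have lift : ∀ (b : X.quiv.A) (z : {z : Y.quiv.V // Y.str.onV z = X.str.onV (X.quiv.s b)}),
      ∃ b', Y.quiv.s b' = z.1 ∧ Y.str.onA b' = X.str.onA b := fun b z =>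
    hY3.2 z.1 _ (hX3.1 b) (by rw [z.2, X.str.s_onA])
  choose l hl1 hl2 using lift
  obtain ⟨c, hc1, hc2⟩ := exists_section hX hr
    (N := fun y => {z : Y.quiv.V // Y.str.onV z = X.str.onV y}) ⟨r', h.symm⟩
    (fun b z => ⟨Y.quiv.t (l b z), by rw [← Y.str.t_onA, hl2 b z, X.str.t_onA]⟩)
  -- Equal images in `Y` have the same last arrow; its start gives equality one step earlier by
  -- induction, and out-injectivity of `X` does the rest. Only the root goes to `r'`, at which no
  -- arrow ends.
  have hinj : ∀ y x, (c y).1 = (c x).1 → y = x := by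
    intro y
    refine tree_induction hr (P := fun y => ∀ x, (c y).1 = (c x).1 → y = x) ?_ ?_ y
    · intro x
      refine tree_induction hr (P := fun x => (c r).1 = (c x).1 → r = x) (fun _ => rfl) ?_ x
      intro b _ hb
      rw [hc1, hc2] at hb
      exact (no_arrow_to_root hr' _ hb.symm).elim
    · intro b ih x
      refine tree_induction hr (P := fun x => (c (X.quiv.t b)).1 = (c x).1 → X.quiv.t b = x)
        ?_ ?_ x
      · intro hb
        rw [hc1, hc2] at hb
        exact (no_arrow_to_root hr' _ hb).elim
      · intro b' _ hb
        rw [hc2, hc2] at hb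
        have e := hY _ _ hb
        have e1 : (c (X.quiv.s b)).1 = (c (X.quiv.s b')).1 := by
          rw [← hl1 b (c _), e, hl1 b' (c _)]
        have e2 : X.str.onA b = X.str.onA b' := by
          rw [← hl2 b (c _), e, hl2 b' (c _)]
        rw [hX2 b b' (ih _ e1) e2]
  have hsurj : ∀ z, ∃ y, (c y).1 = z := by
    intro z
    refine tree_induction hr' (P := fun z => ∃ y, (c y).1 = z) ⟨r, by rw [hc1]⟩ ?_ z
    rintro b' ⟨y, hy⟩
    obtain ⟨b, rfl, hb⟩ := hX3.2 y _ (hY3.1 b') (by rw [← (c y).2, hy, Y.str.s_onA])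
    refine ⟨X.quiv.t b, ?_⟩
    rw [hc2]
    change Y.quiv.t (l b _) = _
    rw [hY2 (l b (c (X.quiv.s b))) b' (by rw [hl1 b (c _), hy])
      (by rw [hl2 b (c _), hb])]
  let f : X ⟶ Y := ⟨⟨fun y => (c y).1, fun b => l b (c (X.quiv.s b)),
    fun b => hl1 b (c _), fun b => by rw [hc2]⟩, by
      apply FinQuiver.Hom.ext
      · funext v; exact (c v).2
      · funext b; exact hl2 b (c _)⟩
  refine nonempty_iso_of_bijective f ⟨fun y x => hinj y x, hsurj⟩ ⟨?_, ?_⟩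
  · intro b b' hb
    replace hb : l b (c (X.quiv.s b)) = l b' (c (X.quiv.s b')) := hb
    refine hX2 b b' (hinj _ _ ?_) ?_
    · rw [← hl1 b (c _), hb, hl1 b' (c _)]
    · rw [← hl2 b (c _), hb, hl2 b' (c _)]
  · intro b'
    obtain ⟨y, hy⟩ := hsurj (Y.quiv.s b')
    obtain ⟨b, rfl, hb⟩ := hX3.2 y _ (hY3.1 b') (by rw [← (c y).2, hy, Y.str.s_onA])
    exact ⟨b, hY2 _ b' (by rw [← hy]; exact hl1 b (c _)) (by rw [← hb]; exact hl2 b (c _))⟩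

end OverQ

/-! ## Intrinsic characterization of the objects `P_T`, `I_T`, `E_T` -/

namespace OverQ

variable {Q : FinQuiver.{u}}

/-- A nonempty path determines its last arrow and the path before it. -/
theorem objP_inUnique [Q.IsAcyclic] (T : Subquiver Q) (i : T.toFinQuiver.V) :
    (objP T i).InUnique := by
  rintro ⟨⟨⟨⟨l, v⟩, hl⟩, a⟩, ha⟩ ⟨⟨⟨⟨m, w⟩, hm⟩, b⟩, hb⟩ h
  have h1 : l ++ [a] = m ++ [b] := congrArg (fun x => x.1.1) h
  have h2 := List.append_inj' h1 rfl
  obtain ⟨rfl, h3⟩ := h2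
  obtain rfl : a = b := by simpa using h3
  simp only at ha hb
  subst ha
  subst hb
  rfl

theorem objP_outInj [Q.IsAcyclic] (T : Subquiver Q) (i : T.toFinQuiver.V) :
    (objP T i).OutInj := by
  rintro ⟨⟨p, a⟩, ha⟩ ⟨⟨q, b⟩, hb⟩ h h2
  have h1 : p = q := h
  have h2 : a.1 = b.1 := h2
  have h3 : a = b := Subtype.ext h2
  subst h1 h3
  rfl

theorem objP_outLift [Q.IsAcyclic] (T : Subquiver Q) (i : T.toFinQuiver.V) :
    (objP T i).OutLift T.arrows := by
  refine ⟨fun a => a.1.2.2, fun v α hα h => ?_⟩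
  exact ⟨⟨(v, ⟨α, hα⟩), Subtype.ext h.symm⟩, rfl, rfl⟩

theorem objP_reachable [Q.IsAcyclic] (T : Subquiver Q) (i : T.toFinQuiver.V)
    (y : (objP T i).quiv.V) : Relation.ReflTransGen (objP T i).quiv.Adj
      (⟨([], i), FinQuiver.IsPath.nil⟩ : {p : List _ × _ // T.toFinQuiver.IsPath i p.1 p.2}) y := by
  obtain ⟨⟨l, v⟩, hl⟩ := y
  change T.toFinQuiver.IsPath i l v at hl
  induction hl with
  | nil => exact .refl
  | snoc a h ih => exact ih.tail ⟨⟨(⟨(_, _), h⟩, a), rfl⟩, rfl, rfl⟩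

theorem objP_pLike [Q.IsAcyclic] (T : Subquiver Q) (i : T.toFinQuiver.V) : (objP T i).PLike :=
  ⟨FinQuiver.isConnected_of_reachable (objP_reachable T i), objP_inUnique T i, objP_outInj T i,
    (objP_outLift T i).range⟩

/-- The opposite of a subquiver. -/
def _root_.QuiverRep.Subquiver.op (T : Subquiver Q) : Subquiver Q.op :=
  ⟨T.verts, T.arrows, T.t_mem, T.s_mem⟩

theorem objI_iLike [Q.IsAcyclic] (T : Subquiver Q) (i : T.toFinQuiver.V) : (objI T i).ILike :=
  ILike.unop (objP_pLike (Q := Q.op) T.op i)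

theorem objE_eLike (T : Subquiver Q) (h : T.toFinQuiver.IsConnected) : (objE T).ELike :=
  ⟨h, Subtype.val_injective, Subtype.val_injective⟩

/-- The root of a tree lies over the unique source of the image. -/
theorem source_iff [Q.IsAcyclic] {X : OverQ Q} {r : X.quiv.V}
    (hr : ∀ y, Relation.ReflTransGen X.quiv.Adj r y) {v : Q.V} (hv : v ∈ Set.range X.str.onV) :
    (∀ a ∈ Set.range X.str.onA, Q.t a ≠ v) ↔ v = X.str.onV r := by
  constructor
  · intro h
    obtain ⟨y, rfl⟩ := hv
    rcases (hr y).cases_tail with h1 | ⟨c, _, b, _, rfl⟩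
    · rw [h1]
    · exact (h _ ⟨b, rfl⟩ (X.str.t_onA b)).elim
  · rintro rfl _ ⟨b, rfl⟩ h
    rw [X.str.t_onA] at h
    exact no_arrow_to_root hr b (eq_root hr h)

theorem image_isUniqueSource [Q.IsAcyclic] {X : OverQ Q} {r : X.quiv.V}
    (hr : ∀ y, Relation.ReflTransGen X.quiv.Adj r y) :
    X.image.toFinQuiver.IsUniqueSource (⟨X.str.onV r, r, rfl⟩ : {v // v ∈ Set.range X.str.onV}) := by
  rintro ⟨v, hv⟩
  have := source_iff hr hv
  constructor
  · intro h
    exact Subtype.ext (this.1 fun a ha hav => h ⟨a, ha⟩ (Subtype.ext hav))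
  · intro h a hav
    exact this.2 (congrArg Subtype.val h) a.1 a.2 (congrArg Subtype.val hav)

/-- `T` is the image and `i` the vertex below the root: both trees then have roots over the same
vertex and the same liftable arrows. -/
theorem PLike.exists_isPIE [Q.IsAcyclic] {X : OverQ Q} (h : X.PLike) :
    ∃ (T : Subquiver Q) (i : T.toFinQuiver.V), T.toFinQuiver.IsUniqueSource i ∧
      Nonempty (X ≅ objP T i) := by
  obtain ⟨r, hr⟩ := exists_root h.connected h.inUnique
  refine ⟨X.image, ⟨X.str.onV r, r, rfl⟩, image_isUniqueSource hr, ?_⟩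
  exact nonempty_iso_of_trees h.inUnique h.outInj h.outLift hr (objP_inUnique _ _)
    (objP_outInj _ _) (objP_outLift _ _) (objP_reachable _ _) rfl

theorem ILike.exists_isPIE [Q.IsAcyclic] {X : OverQ Q} (h : X.ILike) :
    ∃ (T : Subquiver Q) (i : T.toFinQuiver.V), T.toFinQuiver.IsUniqueSink i ∧
      Nonempty (X ≅ objI T i) := by
  obtain ⟨T, i, hi, e⟩ := h.op.exists_isPIE
  exact ⟨⟨T.verts, T.arrows, T.t_mem, T.s_mem⟩, i, hi, nonempty_iso_unop e⟩

/-- An injective structure map is an isomorphism onto its image, and connectedness is transported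
along it. -/
theorem ELike.exists_isPIE {X : OverQ Q} (h : X.ELike) :
    ∃ (T : Subquiver Q), T.toFinQuiver.IsConnected ∧ Nonempty (X ≅ objE T) := by
  let f : X ⟶ objE X.image :=
    ⟨⟨fun v => ⟨X.str.onV v, v, rfl⟩, fun a => ⟨X.str.onA a, a, rfl⟩,
      fun a => Subtype.ext (X.str.s_onA a), fun a => Subtype.ext (X.str.t_onA a)⟩, rfl⟩
  have hV : Function.Bijective f.hom.onV :=
    ⟨fun v w hvw => h.injV (congrArg Subtype.val hvw), by rintro ⟨_, v, rfl⟩; exact ⟨v, rfl⟩⟩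
  have hA : Function.Bijective f.hom.onA :=
    ⟨fun v w hvw => h.injA (congrArg Subtype.val hvw), by rintro ⟨_, v, rfl⟩; exact ⟨v, rfl⟩⟩
  refine ⟨X.image, ?_, nonempty_iso_of_bijective f hV hA⟩
  obtain ⟨r⟩ := h.connected.1
  refine ⟨⟨f.hom.onV r⟩, ?_⟩
  have key : ∀ y : X.quiv.V, Relation.EqvGen X.image.toFinQuiver.Adj (f.hom.onV r) (f.hom.onV y) := by
    refine h.connected.induction (.refl _) fun a => ?_
    have := Relation.EqvGen.rel _ _ (f.hom.adj (X.quiv.adj a))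
    exact ⟨fun h => h.trans _ _ _ this, fun h => h.trans _ _ _ (this.symm _ _)⟩
  intro v w
  obtain ⟨v, rfl⟩ := hV.2 v
  obtain ⟨w, rfl⟩ := hV.2 w
  exact ((key v).symm _ _).trans _ _ _ (key w)

/-- The quivers over `Q` isomorphic to some `P_T`, `I_T` or `E_T`. -/
def PIELike (X : OverQ Q) : Prop := X.PLike ∨ X.ILike ∨ X.ELike

theorem pieLike_of_isPIE [Q.IsAcyclic] {X : OverQ Q} (h : IsPIE Q X) : X.PIELike := by
  cases h with
  | P T i => exact Or.inl (objP_pLike T i)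
  | I T i => exact Or.inr (Or.inl (objI_iLike T i))
  | E T h => exact Or.inr (Or.inr (objE_eLike T h))

theorem PIELike.exists_isPIE [Q.IsAcyclic] {X : OverQ Q} (h : X.PIELike) :
    ∃ Y, IsPIE Q Y ∧ Nonempty (X ≅ Y) := by
  rcases h with h | h | h
  · obtain ⟨T, i, hi, e⟩ := h.exists_isPIE
    exact ⟨_, .P T i hi, e⟩
  · obtain ⟨T, i, hi, e⟩ := h.exists_isPIE
    exact ⟨_, .I T i hi, e⟩
  · obtain ⟨T, hi, e⟩ := h.exists_isPIE
    exact ⟨_, .E T hi, e⟩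

theorem PIELike.connected {X : OverQ Q} (h : X.PIELike) : X.quiv.IsConnected :=
  h.elim PLike.connected fun h => h.elim ILike.connected ELike.connected

theorem PIELike.inInj {X : OverQ Q} (h : X.PIELike) : X.InInj :=
  h.elim (fun h => h.inUnique.inInj) fun h => h.elim ILike.inInj ELike.inInj

theorem PIELike.outInj {X : OverQ Q} (h : X.PIELike) : X.OutInj :=
  h.elim PLike.outInj fun h => h.elim (fun h => h.outUnique.outInj) ELike.outInj

/-! ### Objects of one kind are determined by their image -/

theorem PLike.nonempty_iso [Q.IsAcyclic] {X Y : OverQ Q} (hX : X.PLike) (hY : Y.PLike)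
    (h : X.image = Y.image) : Nonempty (X ≅ Y) := by
  obtain ⟨r, hr⟩ := exists_root hX.connected hX.inUnique
  obtain ⟨r', hr'⟩ := exists_root hY.connected hY.inUnique
  have hV : Set.range X.str.onV = Set.range Y.str.onV := congrArg Subquiver.verts h
  have hA : Set.range X.str.onA = Set.range Y.str.onA := congrArg Subquiver.arrows h
  refine nonempty_iso_of_trees hX.inUnique hX.outInj hX.outLift hr hY.inUnique hY.outInj
    (hA ▸ hY.outLift) hr' ?_
  -- Each root lies over the only source of the common image, so the two roots lie over the same
  -- vertex.
  refine (source_iff hr' (hV ▸ ⟨r, rfl⟩)).1 ?_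
  rw [← hA]
  exact (source_iff hr ⟨r, rfl⟩).2 rfl

theorem ILike.nonempty_iso [Q.IsAcyclic] {X Y : OverQ Q} (hX : X.ILike) (hY : Y.ILike)
    (h : X.image = Y.image) : Nonempty (X ≅ Y) := by
  have hV : Set.range X.str.onV = Set.range Y.str.onV := congrArg Subquiver.verts h
  have hA : Set.range X.str.onA = Set.range Y.str.onA := congrArg Subquiver.arrows h
  exact nonempty_iso_unop (hX.op.nonempty_iso hY.op (Subquiver.ext hV hA))

theorem ELike.nonempty_iso {X Y : OverQ Q} (hX : X.ELike) (hY : Y.ELike)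
    (h : X.image = Y.image) : Nonempty (X ≅ Y) := by
  have hV : Set.range X.str.onV = Set.range Y.str.onV := congrArg Subquiver.verts h
  have hA : Set.range X.str.onA = Set.range Y.str.onA := congrArg Subquiver.arrows h
  have h1 : ∀ v, ∃ w, Y.str.onV w = X.str.onV v := fun v => hV.subset ⟨v, rfl⟩
  have h2 : ∀ v, ∃ w, Y.str.onA w = X.str.onA v := fun v => hA.subset ⟨v, rfl⟩
  have h3 : ∀ v, ∃ w, X.str.onV w = Y.str.onV v := fun v => hV.superset ⟨v, rfl⟩
  have h4 : ∀ v, ∃ w, X.str.onA w = Y.str.onA v := fun v => hA.superset ⟨v, rfl⟩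
  choose g hg using h1
  choose k hk using h2
  let f : X ⟶ Y := ⟨⟨g, k,
    fun a => hY.injV (by rw [hg, ← Y.str.s_onA, hk, X.str.s_onA]),
    fun a => hY.injV (by rw [hg, ← Y.str.t_onA, hk, X.str.t_onA])⟩, by
      apply FinQuiver.Hom.ext
      · funext v; exact hg v
      · funext v; exact hk v⟩
  refine nonempty_iso_of_bijective f ⟨fun v w h => hX.injV ?_, fun w => ?_⟩
    ⟨fun v w h => hX.injA ?_, fun w => ?_⟩
  · rw [← hg v, ← hg w]; exact congrArg Y.str.onV h
  · obtain ⟨v, hv⟩ := h3 w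
    exact ⟨v, hY.injV ((hg v).trans hv)⟩
  · rw [← hk v, ← hk w]; exact congrArg Y.str.onA h
  · obtain ⟨v, hv⟩ := h4 w
    exact ⟨v, hY.injA ((hk v).trans hv)⟩

theorem OutInj.injective_onA {X : OverQ Q} (h : X.OutInj) (hV : Function.Injective X.str.onV) :
    Function.Injective X.str.onA := fun a b hab =>
  h a b (hV (by rw [← X.str.s_onA, hab, X.str.s_onA])) hab

theorem PIELike.eLike {X : OverQ Q} (h : X.PIELike) (hV : Function.Injective X.str.onV) :
    X.ELike := ⟨h.connected, hV, h.outInj.injective_onA hV⟩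

/-- If `X` is a tree as in `PLike`, with the same image as a quiver `Y` with a sink all of whose
vertices lead to it, and the fiber of `X` over this sink is trivial, then all fibers are trivial. -/
theorem PLike.injective_onV {X Y : OverQ Q} (hX : X.PLike)
    (h : X.image = Y.image) {q : Y.quiv.V} (hq : ∀ y, Relation.ReflTransGen Y.quiv.Adj y q)
    (hf : ∀ y1 y2, X.str.onV y1 = Y.str.onV q → X.str.onV y2 = Y.str.onV q → y1 = y2) :
    Function.Injective X.str.onV := by
  have hV : Set.range X.str.onV = Set.range Y.str.onV := congrArg Subquiver.verts h
  have hA : Set.range X.str.onA = Set.range Y.str.onA := congrArg Subquiver.arrows h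
  -- Triviality of fibers travels backwards from the sink. Two points over the start of an arrow
  -- lift it to two arrows whose ends agree, and in-uniqueness identifies these arrows.
  have key : ∀ z y1 y2, X.str.onV y1 = Y.str.onV z → X.str.onV y2 = Y.str.onV z → y1 = y2 := by
    intro z
    induction hq z using Relation.ReflTransGen.head_induction_on with
    | refl => exact hf
    | head h2 _ ih =>
      obtain ⟨b, rfl, rfl⟩ := h2
      intro y1 y2 h1 h2
      have hb : Y.str.onA b ∈ Set.range X.str.onA := hA ▸ ⟨b, rfl⟩
      obtain ⟨a1, rfl, ha1⟩ := hX.outLift.2 y1 _ hb (by rw [h1, Y.str.s_onA])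
      obtain ⟨a2, rfl, ha2⟩ := hX.outLift.2 y2 _ hb (by rw [h2, Y.str.s_onA])
      rw [hX.inUnique a1 a2 (ih _ _ (by rw [← X.str.t_onA, ha1, Y.str.t_onA])
        (by rw [← X.str.t_onA, ha2, Y.str.t_onA]))]
  intro y1 y2 h12
  obtain ⟨z, hz⟩ : X.str.onV y1 ∈ Set.range Y.str.onV := hV ▸ ⟨y1, rfl⟩
  exact key z y1 y2 hz.symm (by rw [← h12, hz])

/-! ## Connected components -/

/-- Connectedness of vertices. -/
def compSetoid (X : OverQ Q) : Setoid X.quiv.V :=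
  Relation.EqvGen.setoid fun x y => ∃ a, X.quiv.s a = x ∧ X.quiv.t a = y

theorem comp_eq (X : OverQ Q) (a : X.quiv.A) :
    (Quotient.mk X.compSetoid (X.quiv.s a)) = Quotient.mk X.compSetoid (X.quiv.t a) :=
  Quotient.sound (.rel _ _ ⟨a, rfl, rfl⟩)

/-- A connected component. -/
def component (X : OverQ Q) (k : Quotient X.compSetoid) : OverQ Q where
  quiv :=
    { V := {v : X.quiv.V // Quotient.mk X.compSetoid v = k}
      A := {a : X.quiv.A // Quotient.mk X.compSetoid (X.quiv.s a) = k}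
      s := fun a => ⟨X.quiv.s a.1, a.2⟩
      t := fun a => ⟨X.quiv.t a.1, (X.comp_eq a.1).symm.trans a.2⟩
      finV := inferInstance
      finA := inferInstance }
  str := ⟨fun v => X.str.onV v.1, fun a => X.str.onA a.1, fun a => X.str.s_onA a.1,
    fun a => X.str.t_onA a.1⟩

theorem component_isConnected (X : OverQ Q) (k : Quotient X.compSetoid) :
    (X.component k).quiv.IsConnected := by
  obtain ⟨r, hr⟩ := Quotient.exists_rep k
  have key : ∀ x y, Relation.EqvGen (fun x y => ∃ a, X.quiv.s a = x ∧ X.quiv.t a = y) x y →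
      ∀ (hx : Quotient.mk X.compSetoid x = k) (hy : Quotient.mk X.compSetoid y = k),
      Relation.EqvGen (X.component k).quiv.Adj ⟨x, hx⟩ ⟨y, hy⟩ := by
    intro x y h
    induction h with
    | rel _ _ h => obtain ⟨a, rfl, rfl⟩ := h; exact fun hx hy => .rel _ _ ⟨⟨a, hx⟩, rfl, rfl⟩
    | refl => exact fun _ _ => .refl _
    | symm _ _ _ ih => exact fun hx hy => (ih hy hx).symm
    | trans _ _ _ h _ ih ih2 =>
      exact fun hx hy => (ih hx ((Quotient.sound h).symm.trans hx)).trans _ _ _ (ih2 _ hy)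
  refine ⟨⟨⟨r, hr⟩⟩, ?_⟩
  rintro ⟨v, hv⟩ ⟨w, hw⟩
  exact key v w (Quotient.exact (hv.trans hw.symm)) hv hw

theorem InUnique.component {X : OverQ Q} (h : X.InUnique) (k) : (X.component k).InUnique :=
  fun a b hab => Subtype.ext (h a.1 b.1 (congrArg Subtype.val hab))

theorem OutUnique.component {X : OverQ Q} (h : X.OutUnique) (k) : (X.component k).OutUnique :=
  fun a b hab => Subtype.ext (h a.1 b.1 (congrArg Subtype.val hab))

theorem InInj.component {X : OverQ Q} (h : X.InInj) (k) : (X.component k).InInj :=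
  fun a b hab hf => Subtype.ext (h a.1 b.1 (congrArg Subtype.val hab) hf)

theorem OutInj.component {X : OverQ Q} (h : X.OutInj) (k) : (X.component k).OutInj :=
  fun a b hab hf => Subtype.ext (h a.1 b.1 (congrArg Subtype.val hab) hf)

theorem OutLift.component {X : OverQ Q} {S : Set Q.A} (h : X.OutLift S) (k) :
    (X.component k).OutLift S := by
  refine ⟨fun a => h.1 a.1, ?_⟩
  rintro ⟨v, hv⟩ α hα h2
  obtain ⟨a, rfl, ha⟩ := h.2 v α hα h2
  exact ⟨⟨a, hv⟩, rfl, ha⟩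

theorem InLift.component {X : OverQ Q} {S : Set Q.A} (h : X.InLift S) (k) :
    (X.component k).InLift S := by
  refine ⟨fun a => h.1 a.1, ?_⟩
  rintro ⟨v, hv⟩ α hα h2
  obtain ⟨a, rfl, ha⟩ := h.2 v α hα h2
  exact ⟨⟨a, (X.comp_eq a).trans hv⟩, rfl, ha⟩

/-- A quiver over `Q` is the disjoint union of quivers isomorphic to its components. -/
theorem nonempty_iso_disjointUnion (X : OverQ Q) {n : ℕ} (e : Fin n ≃ Quotient X.compSetoid)
    (w : Fin n → OverQ Q) (g : ∀ k, w k ≅ X.component (e k)) :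
    Nonempty (X ≅ OverQ.disjointUnion w) := by
  have hV : ∀ k v, (g k).inv.hom.onV ((g k).hom.hom.onV v) = v := fun k v =>
    congrArg (fun f : w k ⟶ w k => f.hom.onV v) (g k).hom_inv_id
  have hV2 : ∀ k v, (g k).hom.hom.onV ((g k).inv.hom.onV v) = v := fun k v =>
    congrArg (fun f : X.component (e k) ⟶ X.component (e k) => f.hom.onV v) (g k).inv_hom_id
  have hA : ∀ k v, (g k).inv.hom.onA ((g k).hom.hom.onA v) = v := fun k v =>
    congrArg (fun f : w k ⟶ w k => f.hom.onA v) (g k).hom_inv_id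
  have hA2 : ∀ k v, (g k).hom.hom.onA ((g k).inv.hom.onA v) = v := fun k v =>
    congrArg (fun f : X.component (e k) ⟶ X.component (e k) => f.hom.onA v) (g k).inv_hom_id
  let f : OverQ.disjointUnion w ⟶ X := ⟨⟨fun v => ((g v.1).hom.hom.onV v.2).1,
    fun a => ((g a.1).hom.hom.onA a.2).1,
    fun a => congrArg Subtype.val ((g a.1).hom.hom.s_onA a.2),
    fun a => congrArg Subtype.val ((g a.1).hom.hom.t_onA a.2)⟩, by
      apply FinQuiver.Hom.ext
      · funext v; exact hom_onV (g v.1).hom v.2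
      · funext v; exact hom_onA (g v.1).hom v.2⟩
  suffices h : Nonempty (OverQ.disjointUnion w ≅ X) from ⟨h.some.symm⟩
  refine nonempty_iso_of_bijective f ⟨?_, ?_⟩ ⟨?_, ?_⟩
  · rintro ⟨k, v⟩ ⟨l, v'⟩ h
    replace h : ((g k).hom.hom.onV v).1 = ((g l).hom.hom.onV v').1 := h
    obtain rfl : k = l := e.injective (by
      rw [← ((g k).hom.hom.onV v).2, h, ((g l).hom.hom.onV v').2])
    rw [← hV k v, Subtype.ext h, hV]
  · intro x
    obtain ⟨k, hk⟩ := e.surjective (Quotient.mk _ x)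
    exact ⟨⟨k, (g k).inv.hom.onV ⟨x, hk.symm⟩⟩, congrArg Subtype.val (hV2 k ⟨x, hk.symm⟩)⟩
  · rintro ⟨k, v⟩ ⟨l, v'⟩ h
    replace h : ((g k).hom.hom.onA v).1 = ((g l).hom.hom.onA v').1 := h
    obtain rfl : k = l := e.injective (by
      rw [← ((g k).hom.hom.onA v).2, h, ((g l).hom.hom.onA v').2])
    rw [← hA k v, Subtype.ext h, hA]
  · intro x
    obtain ⟨k, hk⟩ := e.surjective (Quotient.mk _ (X.quiv.s x))
    exact ⟨⟨k, (g k).inv.hom.onA ⟨x, hk.symm⟩⟩, congrArg Subtype.val (hA2 k ⟨x, hk.symm⟩)⟩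

/-! ## Fiber products -/

section FiberProd

variable {X Y : OverQ Q}

/-- One in-unique factor suffices: the end determines the arrow of `X`, hence the arrow of `Q`
below, and then in-injectivity determines the arrow of `Y`. -/
theorem InUnique.fiberProd (hX : X.InUnique) (hY : Y.InInj) : (X.fiberProd Y).InUnique := by
  rintro ⟨⟨a, b⟩, h⟩ ⟨⟨a', b'⟩, h'⟩ e
  have e1 : X.quiv.t a = X.quiv.t a' := congrArg (fun x => x.1.1) e
  have e2 : Y.quiv.t b = Y.quiv.t b' := congrArg (fun x => x.1.2) e
  obtain rfl := hX _ _ e1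
  obtain rfl := hY _ _ e2 (h.symm.trans h')
  rfl

theorem OutUnique.fiberProd (hX : X.OutInj) (hY : Y.OutUnique) : (X.fiberProd Y).OutUnique := by
  rintro ⟨⟨a, b⟩, h⟩ ⟨⟨a', b'⟩, h'⟩ e
  have e1 : X.quiv.s a = X.quiv.s a' := congrArg (fun x => x.1.1) e
  have e2 : Y.quiv.s b = Y.quiv.s b' := congrArg (fun x => x.1.2) e
  obtain rfl := hY _ _ e2
  obtain rfl := hX _ _ e1 (h.trans h'.symm)
  rfl

theorem InInj.fiberProd (hX : X.InInj) (hY : Y.InInj) : (X.fiberProd Y).InInj := by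
  rintro ⟨⟨a, b⟩, h⟩ ⟨⟨a', b'⟩, h'⟩ e f
  have e1 : X.quiv.t a = X.quiv.t a' := congrArg (fun x => x.1.1) e
  have e2 : Y.quiv.t b = Y.quiv.t b' := congrArg (fun x => x.1.2) e
  obtain rfl := hX _ _ e1 f
  obtain rfl := hY _ _ e2 (h.symm.trans h')
  rfl

theorem OutInj.fiberProd (hX : X.OutInj) (hY : Y.OutInj) : (X.fiberProd Y).OutInj := by
  rintro ⟨⟨a, b⟩, h⟩ ⟨⟨a', b'⟩, h'⟩ e f
  have e1 : X.quiv.s a = X.quiv.s a' := congrArg (fun x => x.1.1) e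
  have e2 : Y.quiv.s b = Y.quiv.s b' := congrArg (fun x => x.1.2) e
  obtain rfl := hX _ _ e1 f
  obtain rfl := hY _ _ e2 (h.symm.trans h')
  rfl

theorem OutLift.fiberProd {S T : Set Q.A} (hX : X.OutLift S) (hY : Y.OutLift T) :
    (X.fiberProd Y).OutLift (S ∩ T) := by
  refine ⟨fun a => ⟨hX.1 a.1.1, ?_⟩, ?_⟩
  · change X.str.onA a.1.1 ∈ T
    rw [a.2]; exact hY.1 a.1.2
  · rintro ⟨⟨v, w⟩, h⟩ α ⟨h1, h2⟩ hα
    replace hα : Q.s α = X.str.onV v := hα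
    obtain ⟨a, rfl, ha⟩ := hX.2 v α h1 hα
    obtain ⟨b, rfl, hb⟩ := hY.2 w α h2 (hα.trans h)
    exact ⟨⟨(a, b), ha.trans hb.symm⟩, rfl, ha⟩

theorem InLift.fiberProd {S T : Set Q.A} (hX : X.InLift S) (hY : Y.InLift T) :
    (X.fiberProd Y).InLift (S ∩ T) := by
  refine ⟨fun a => ⟨hX.1 a.1.1, ?_⟩, ?_⟩
  · change X.str.onA a.1.1 ∈ T
    rw [a.2]; exact hY.1 a.1.2
  · rintro ⟨⟨v, w⟩, h⟩ α ⟨h1, h2⟩ hα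
    replace hα : Q.t α = X.str.onV v := hα
    obtain ⟨a, rfl, ha⟩ := hX.2 v α h1 hα
    obtain ⟨b, rfl, hb⟩ := hY.2 w α h2 (hα.trans h)
    exact ⟨⟨(a, b), ha.trans hb.symm⟩, rfl, ha⟩

end FiberProd

/-- A connected quiver over `Q` without branching is an embedded path. -/
theorem eLike_of_inUnique_of_outUnique [Q.IsAcyclic] {X : OverQ Q} (hc : X.quiv.IsConnected)
    (h1 : X.InUnique) (h2 : X.OutUnique) : X.ELike := by
  obtain ⟨r, hr⟩ := exists_root hc h1
  -- Any two vertices are comparable: if `z` can be reached from the start of `b`, then either it is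
  -- that start or the path begins with `b`, the only arrow there.
  have key : ∀ y z, Relation.ReflTransGen X.quiv.Adj z y ∨ Relation.ReflTransGen X.quiv.Adj y z := by
    intro y z
    refine tree_induction hr (P := fun y => Relation.ReflTransGen X.quiv.Adj z y ∨
      Relation.ReflTransGen X.quiv.Adj y z) (Or.inr (hr z)) ?_ y
    rintro b (h | h)
    · exact Or.inl (h.tail (X.quiv.adj b))
    · rcases h.cases_head with rfl | ⟨c, ⟨b', hb', rfl⟩, h⟩
      · exact Or.inl (.single (X.quiv.adj b))
      · rw [h2 b b' hb'.symm]
        exact Or.inr h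
  have hV : Function.Injective X.str.onV := by
    intro y z h
    rcases key y z with h' | h'
    · exact (X.str.eq_of_reflTransGen h' h.symm).symm
    · exact X.str.eq_of_reflTransGen h' h
  exact ⟨hc, hV, h2.outInj.injective_onA hV⟩

/-- The components of a fiber product of the `P_T`, `I_T`, `E_T` are of the same kind. -/
theorem PIELike.fiberProd_component [Q.IsAcyclic] {X Y : OverQ Q} (hX : X.PIELike)
    (hY : Y.PIELike) (k) : ((X.fiberProd Y).component k).PIELike := by
  have hc := (X.fiberProd Y).component_isConnected k
  have inU : X.InUnique ∨ Y.InUnique → (X.fiberProd Y).InUnique := by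
    rintro (h | h)
    · exact h.fiberProd hY.inInj
    · rintro ⟨⟨a, b⟩, h1⟩ ⟨⟨a', b'⟩, h2⟩ e
      have e1 : X.quiv.t a = X.quiv.t a' := congrArg (fun x => x.1.1) e
      have e2 : Y.quiv.t b = Y.quiv.t b' := congrArg (fun x => x.1.2) e
      obtain rfl := h _ _ e2
      obtain rfl := hX.inInj _ _ e1 (h1.trans h2.symm)
      rfl
  have outU : X.OutUnique ∨ Y.OutUnique → (X.fiberProd Y).OutUnique := by
    rintro (h | h)
    · rintro ⟨⟨a, b⟩, h1⟩ ⟨⟨a', b'⟩, h2⟩ e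
      have e1 : X.quiv.s a = X.quiv.s a' := congrArg (fun x => x.1.1) e
      have e2 : Y.quiv.s b = Y.quiv.s b' := congrArg (fun x => x.1.2) e
      obtain rfl := h _ _ e1
      obtain rfl := hY.outInj _ _ e2 (h1.symm.trans h2)
      rfl
    · exact OutUnique.fiberProd hX.outInj h
  -- A tree times a tree or an embedded quiver: arrows lift forwards in both factors, and
  -- in-uniqueness in one factor is enough.
  have pCase : X.InUnique ∨ Y.InUnique → X.OutLift (Set.range X.str.onA) →
      Y.OutLift (Set.range Y.str.onA) → ((X.fiberProd Y).component k).PIELike := fun h h1 h2 =>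
    Or.inl ⟨hc, (inU h).component k, (hX.outInj.fiberProd hY.outInj).component k,
      ((h1.fiberProd h2).component k).range⟩
  have iCase : X.OutUnique ∨ Y.OutUnique → X.InLift (Set.range X.str.onA) →
      Y.InLift (Set.range Y.str.onA) → ((X.fiberProd Y).component k).PIELike := fun h h1 h2 =>
    Or.inr (Or.inl ⟨hc, (outU h).component k, (hX.inInj.fiberProd hY.inInj).component k,
      ((h1.fiberProd h2).component k).range⟩)
  -- P times I: the product branches in neither direction, so its components are embedded paths.
  have mixed : X.InUnique ∨ Y.InUnique → X.OutUnique ∨ Y.OutUnique →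
      ((X.fiberProd Y).component k).PIELike := fun h1 h2 =>
    Or.inr (Or.inr (eLike_of_inUnique_of_outUnique hc ((inU h1).component k)
      ((outU h2).component k)))
  rcases hX with h | h | h <;> rcases hY with h' | h' | h'
  · exact pCase (.inl h.inUnique) h.outLift h'.outLift
  · exact mixed (.inl h.inUnique) (.inr h'.outUnique)
  · exact pCase (.inl h.inUnique) h.outLift h'.outLift
  · exact mixed (.inr h'.inUnique) (.inl h.outUnique)
  · exact iCase (.inl h.outUnique) h.inLift h'.inLift
  · exact iCase (.inl h.outUnique) h.inLift h'.inLift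
  · exact pCase (.inr h'.inUnique) h.outLift h'.outLift
  · exact iCase (.inr h'.outUnique) h.inLift h'.inLift
  · have hV : Function.Injective (X.fiberProd Y).str.onV := by
      rintro ⟨⟨a, b⟩, h1⟩ ⟨⟨a', b'⟩, h2⟩ e
      obtain rfl : a = a' := h.injV e
      obtain rfl : b = b' := h'.injV (h1.symm.trans h2)
      rfl
    have hV2 : Function.Injective ((X.fiberProd Y).component k).str.onV :=
      fun a b hab => Subtype.ext (hV hab)
    exact Or.inr (Or.inr ⟨hc, hV2,
      ((h.outInj.fiberProd h'.outInj).component k).injective_onA hV2⟩)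

/-! ## Endomorphisms -/

/-- The image of an arrow is determined by its start and by the arrow of `Q` below it. -/
theorem hom_ext_of_onV {X Y : OverQ Q} (hY : Y.OutInj) {f g : X ⟶ Y}
    (h : f.hom.onV = g.hom.onV) : f = g := by
  apply OverQ.Hom.ext; apply FinQuiver.Hom.ext h
  funext a
  exact hY _ _ (by rw [f.hom.s_onA, g.hom.s_onA, h]) (by rw [hom_onA, hom_onA])

/-- The root is fixed, being alone in its fiber, and out-injectivity carries this along the arrows
of the tree. -/
theorem PLike.endo [Q.IsAcyclic] {X : OverQ Q} (hX : X.PLike) (f : X ⟶ X) : f = 𝟙 X := by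
  obtain ⟨r, hr⟩ := exists_root hX.connected hX.inUnique
  refine hom_ext_of_onV hX.outInj (funext fun y => ?_)
  change f.hom.onV y = y
  refine tree_induction hr (P := fun y => f.hom.onV y = y) (eq_root hr (hom_onV f r)) ?_ y
  intro b hb
  have : f.hom.onA b = b := hX.outInj _ _ (by rw [f.hom.s_onA, hb]) (hom_onA f b)
  rw [← f.hom.t_onA, this]

theorem PIELike.endo [Q.IsAcyclic] {X : OverQ Q} (hX : X.PIELike) (f : X ⟶ X) : f = 𝟙 X := by
  rcases hX with h | h | h
  · exact h.endo f
  · let g : X.op ⟶ X.op := ⟨⟨f.hom.onV, f.hom.onA, f.hom.t_onA, f.hom.s_onA⟩, by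
      apply FinQuiver.Hom.ext
      · funext v; exact hom_onV f v
      · funext v; exact hom_onA f v⟩
    have hg := h.op.endo g
    have h1 : f.hom.onV = fun v => v := congrArg (fun g : X.op ⟶ X.op => g.hom.onV) hg
    exact hom_ext_of_onV h.outUnique.outInj h1
  · exact hom_ext_of_onV h.outInj (funext fun y => h.injV (hom_onV f y))

/-! ## Counting morphisms -/

instance (X Y : OverQ Q) : Finite (X ⟶ Y) :=
  Finite.of_injective (fun f : X ⟶ Y => (f.hom.onV, f.hom.onA)) (by
    intro f g h
    simp only [Prod.mk.injEq] at h
    exact OverQ.Hom.ext (FinQuiver.Hom.ext h.1 h.2))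

/-- The universal property of the fiber product, counted: this makes marks multiplicative. -/
theorem card_hom_fiberProd (Z X Y : OverQ Q) :
    Nat.card (Z ⟶ X.fiberProd Y) = Nat.card (Z ⟶ X) * Nat.card (Z ⟶ Y) := by
  rw [← Nat.card_prod]
  let p1 : X.fiberProd Y ⟶ X := ⟨⟨fun p => p.1.1, fun p => p.1.1, fun _ => rfl, fun _ => rfl⟩, rfl⟩
  let p2 : X.fiberProd Y ⟶ Y := ⟨⟨fun p => p.1.2, fun p => p.1.2, fun _ => rfl, fun _ => rfl⟩, by
    apply FinQuiver.Hom.ext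
    · funext v; exact v.2.symm
    · funext v; exact v.2.symm⟩
  refine Nat.card_congr (Equiv.ofBijective (fun f => (f ≫ p1, f ≫ p2)) ⟨?_, ?_⟩)
  · intro f g h
    simp only [Prod.mk.injEq] at h
    apply OverQ.Hom.ext; apply FinQuiver.Hom.ext
    · funext v
      exact Subtype.ext (Prod.ext (congrArg (fun f : Z ⟶ X => f.hom.onV v) h.1)
        (congrArg (fun f : Z ⟶ Y => f.hom.onV v) h.2))
    · funext v
      exact Subtype.ext (Prod.ext (congrArg (fun f : Z ⟶ X => f.hom.onA v) h.1)
        (congrArg (fun f : Z ⟶ Y => f.hom.onA v) h.2))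
  · rintro ⟨f, g⟩
    refine ⟨⟨⟨fun v => ⟨(f.hom.onV v, g.hom.onV v), by rw [hom_onV, hom_onV]⟩,
      fun v => ⟨(f.hom.onA v, g.hom.onA v), by rw [hom_onA, hom_onA]⟩, fun a => ?_, fun a => ?_⟩,
      ?_⟩, rfl⟩
    · exact Subtype.ext (Prod.ext (f.hom.s_onA a) (g.hom.s_onA a))
    · exact Subtype.ext (Prod.ext (f.hom.t_onA a) (g.hom.t_onA a))
    · apply FinQuiver.Hom.ext
      · funext v; exact hom_onV f v
      · funext v; exact hom_onA f v

/-- A connected quiver maps into a single summand, and nonemptiness makes that summand unique: this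
makes marks additive. -/
theorem card_hom_disjointUnion (Z : OverQ Q) (hZ : Z.quiv.IsConnected) {n : ℕ}
    (w : Fin n → OverQ Q) :
    Nat.card (Z ⟶ OverQ.disjointUnion w) = ∑ k, Nat.card (Z ⟶ w k) := by
  rw [← Nat.card_sigma]
  refine (Nat.card_congr (Equiv.ofBijective (fun f : Σ k, (Z ⟶ w k) =>
    (⟨⟨fun v => ⟨f.1, f.2.hom.onV v⟩, fun a => ⟨f.1, f.2.hom.onA a⟩,
      fun a => by rw [← f.2.hom.s_onA]; rfl, fun a => by rw [← f.2.hom.t_onA]; rfl⟩, by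
        apply FinQuiver.Hom.ext
        · funext v; exact hom_onV f.2 v
        · funext v; exact hom_onA f.2 v⟩ : Z ⟶ OverQ.disjointUnion w)) ⟨?_, ?_⟩)).symm
  · rintro ⟨k, f⟩ ⟨l, g⟩ h
    obtain ⟨r⟩ := hZ.1
    have hV : ∀ v, (⟨k, f.hom.onV v⟩ : Σ k, (w k).quiv.V) = ⟨l, g.hom.onV v⟩ := fun v =>
      congrArg (fun f : Z ⟶ OverQ.disjointUnion w => f.hom.onV v) h
    have hA : ∀ v, (⟨k, f.hom.onA v⟩ : Σ k, (w k).quiv.A) = ⟨l, g.hom.onA v⟩ := fun v =>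
      congrArg (fun f : Z ⟶ OverQ.disjointUnion w => f.hom.onA v) h
    obtain rfl : k = l := congrArg Sigma.fst (hV r)
    congr 1
    apply OverQ.Hom.ext; apply FinQuiver.Hom.ext
    · funext v; simpa using hV v
    · funext v; simpa using hA v
  · intro f
    obtain ⟨r⟩ := hZ.1
    have h1 : ∀ v, (f.hom.onV v).1 = (f.hom.onV r).1 :=
      hZ.induction (P := fun v => (f.hom.onV v).1 = (f.hom.onV r).1) rfl fun a => by
        rw [← f.hom.s_onA, ← f.hom.t_onA]; rfl
    generalize (f.hom.onV r).1 = k at h1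
    have h2 : ∀ v, ∃ y, f.hom.onV v = ⟨k, y⟩ := by
      intro v
      have := h1 v
      generalize f.hom.onV v = x at this
      obtain ⟨l, y⟩ := x
      obtain rfl : l = k := this
      exact ⟨y, rfl⟩
    have h3 : ∀ a, ∃ y, f.hom.onA a = ⟨k, y⟩ := by
      intro a
      have : (f.hom.onA a).1 = k := by
        rw [← h1 (Z.quiv.s a), ← f.hom.s_onA]; rfl
      generalize f.hom.onA a = x at this
      obtain ⟨l, y⟩ := x
      obtain rfl : l = k := this
      exact ⟨y, rfl⟩
    choose g hg using h2
    choose m hm using h3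
    refine ⟨⟨k, ⟨g, m, fun a => ?_, fun a => ?_⟩, ?_⟩, ?_⟩
    · have := f.hom.s_onA a
      rw [hm, hg] at this
      simpa [OverQ.disjointUnion] using this
    · have := f.hom.t_onA a
      rw [hm, hg] at this
      simpa [OverQ.disjointUnion] using this
    · apply FinQuiver.Hom.ext
      · funext v
        have := hom_onV f v
        rw [hg] at this
        exact this
      · funext v
        have := hom_onA f v
        rw [hm] at this
        exact this
    · apply OverQ.Hom.ext; apply FinQuiver.Hom.ext
      · funext v; exact (hg v).symm
      · funext v; exact (hm v).symm

/-- `Q` as a quiver over itself. -/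
def terminal (Q : FinQuiver.{u}) : OverQ Q := ⟨Q, FinQuiver.Hom.id Q⟩

theorem card_hom_terminal (Z : OverQ Q) : Nat.card (Z ⟶ terminal Q) = 1 := by
  have : Unique (Z ⟶ terminal Q) :=
    { default := ⟨Z.str, rfl⟩
      uniq := fun f => by
        apply OverQ.Hom.ext
        apply FinQuiver.Hom.ext
        · funext v; exact hom_onV f v
        · funext v; exact hom_onA f v }
  exact Nat.card_unique

/-- `Q` need not be connected, so the unit of the ring is represented by the sum of its components,
each of kind E. -/
theorem terminal_component (k) : ((terminal Q).component k).PIELike :=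
  Or.inr (Or.inr ⟨component_isConnected _ k, Subtype.val_injective, Subtype.val_injective⟩)

end OverQ

/-! ## Linearizations -/

section Linearization

variable {K : Type u} [Field K] {Q : FinQuiver.{u}}

/-- A linearization as a space of functions on a fiber. -/
noncomputable def linEquiv (X : OverQ Q) (x : Q.V) :
    (linearization K X).sp x ≃ₗ[K] ({y : X.quiv.V // X.str.onV y = x} → K) :=
  LinearEquiv.refl K ({y : X.quiv.V // X.str.onV y = x} → K)

open Classical in
/-- The standard basis of a linearization. -/
noncomputable def bas (X : OverQ Q) {x : Q.V} (y : X.quiv.V) (h : X.str.onV y = x) :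
    (linearization K X).sp x :=
  (linEquiv X x).symm (Pi.single ⟨y, h⟩ 1)

/-- The coordinates on a linearization. -/
noncomputable def coord (X : OverQ Q) {x : Q.V} (y : X.quiv.V) (h : X.str.onV y = x) :
    (linearization K X).sp x →ₗ[K] K :=
  LinearMap.proj (φ := fun _ => K) (⟨y, h⟩ : {y : X.quiv.V // X.str.onV y = x}) ∘ₗ
    (linEquiv X x).toLinearMap

theorem coord_apply (X : OverQ Q) {x : Q.V} (y : X.quiv.V) (h : X.str.onV y = x)
    (v : (linearization K X).sp x) : coord X y h v = linEquiv X x v ⟨y, h⟩ := rfl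

theorem coord_bas_self (X : OverQ Q) {x : Q.V} (y : X.quiv.V) (h : X.str.onV y = x) :
    coord X y h (bas X y h) = (1 : K) := by
  classical
  rw [coord_apply, bas, LinearEquiv.apply_symm_apply, Pi.single_eq_same]

theorem coord_bas_of_ne (X : OverQ Q) {x : Q.V} {y z : X.quiv.V} (h : X.str.onV y = x)
    (h2 : X.str.onV z = x) (hyz : z ≠ y) : coord X z h2 (bas X y h) = (0 : K) := by
  classical
  rw [coord_apply, bas, LinearEquiv.apply_symm_apply, Pi.single_eq_of_ne]
  exact fun e => hyz (congrArg Subtype.val e)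

theorem coord_congr (X : OverQ Q) {x : Q.V} {y z : X.quiv.V} (h : X.str.onV y = x)
    (h2 : X.str.onV z = x) (hyz : z = y) (v : (linearization K X).sp x) :
    coord X z h2 v = coord X y h v := by
  subst hyz; rfl

theorem lin_ext {X : OverQ Q} {x : Q.V} {v w : (linearization K X).sp x}
    (h : ∀ y (hy : X.str.onV y = x), coord X y hy v = coord X y hy w) : v = w :=
  (linEquiv X x).injective (funext fun y => h y.1 y.2)

theorem exists_coord_eq (X : OverQ Q) {x : Q.V} {M : Type*} [AddCommGroup M] [Module K M]
    (c : ∀ y, X.str.onV y = x → (M →ₗ[K] K)) :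
    ∃ f : M →ₗ[K] (linearization K X).sp x, ∀ y hy v, coord X y hy (f v) = c y hy v := by
  refine ⟨(linEquiv X x).symm.toLinearMap ∘ₗ LinearMap.pi fun y => c y.1 y.2, fun y hy v => ?_⟩
  rw [coord_apply, LinearMap.comp_apply, LinearEquiv.coe_coe, LinearEquiv.apply_symm_apply]
  rfl

theorem lin_hom_ext {X : OverQ Q} {x : Q.V} {M : Type*} [AddCommGroup M] [Module K M]
    {f g : (linearization K X).sp x →ₗ[K] M}
    (h : ∀ y (hy : X.str.onV y = x), f (bas X y hy) = g (bas X y hy)) : f = g := by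
  classical
  refine ((Pi.basisFun K {y : X.quiv.V // X.str.onV y = x}).map (linEquiv X x).symm).ext
    fun y => ?_
  have := h y.1 y.2
  rw [Module.Basis.map_apply, Pi.basisFun_apply]
  rw [bas] at this
  convert this

/-- A linear map with prescribed values on the standard basis. -/
theorem exists_linearMap (X : OverQ Q) {x : Q.V} {M : Type*} [AddCommGroup M] [Module K M]
    (c : ∀ y, X.str.onV y = x → M) :
    ∃ f : (linearization K X).sp x →ₗ[K] M, ∀ y hy, f (bas X y hy) = c y hy := by
  classical
  let B := (Pi.basisFun K {y : X.quiv.V // X.str.onV y = x}).map (linEquiv X x).symm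
  refine ⟨B.constr K fun y => c y.1 y.2, fun y hy => ?_⟩
  have h : bas X y hy = B ⟨y, hy⟩ := by
    rw [Module.Basis.map_apply, Pi.basisFun_apply, bas]
  rw [h, Module.Basis.constr_basis]

open Classical in
theorem lin_map_apply (X : OverQ Q) (a : Q.A) (v : (linearization K X).sp (Q.s a)) (z : X.quiv.V)
    (hz : X.str.onV z = Q.t a) [hF : Fintype {b : X.quiv.A // X.str.onA b = a}] :
    coord X z hz ((linearization K X).map a v) = ∑ b : {b : X.quiv.A // X.str.onA b = a},
      if X.quiv.t b.1 = z then coord X (X.quiv.s b.1) (by rw [← X.str.s_onA, b.2]) v else 0 := by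
  have h : coord X z hz ((linearization K X).map a v) =
      ((∑ b : {b : X.quiv.A // X.str.onA b = a},
        (LinearMap.single K (fun _ : {y : X.quiv.V // X.str.onV y = Q.t a} => K)
          ⟨X.quiv.t b.1, by rw [← X.str.t_onA, b.2]⟩) ∘ₗ LinearMap.id ∘ₗ
        (LinearMap.proj (φ := fun _ : {y : X.quiv.V // X.str.onV y = Q.s a} => K)
          ⟨X.quiv.s b.1, by rw [← X.str.s_onA, b.2]⟩)) : ({y : X.quiv.V // X.str.onV y = Q.s a} → K) →ₗ[K]
          ({y : X.quiv.V // X.str.onV y = Q.t a} → K))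
      (linEquiv X _ v) ⟨z, hz⟩ := by
    -- `pushforward` sums with the instance `Fintype.ofFinite`; once the given instance is
    -- identified with it, both sides agree by definition.
    obtain rfl : hF = Fintype.ofFinite _ := Subsingleton.elim _ _
    rfl
  rw [h, LinearMap.sum_apply, Finset.sum_apply]
  refine Finset.sum_congr rfl fun b _ => ?_
  simp only [LinearMap.comp_apply, LinearMap.coe_single, LinearMap.proj_apply, LinearMap.id_apply,
    Pi.single_apply, coord_apply, Subtype.mk.injEq]
  exact if_congr eq_comm rfl rfl

/-- With in-injectivity only `b` contributes to the coordinate at its end. Coordinates are thus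
pulled back along arrows, dually to `map_bas`, where out-injectivity pushes basis vectors forward.
-/
theorem coord_map_target {X : OverQ Q} (hX : X.InInj) {a : Q.A} (b : X.quiv.A)
    (hb : X.str.onA b = a) (v : (linearization K X).sp (Q.s a)) :
    coord X (X.quiv.t b) (by rw [← X.str.t_onA, hb]) ((linearization K X).map a v) =
      coord X (X.quiv.s b) (by rw [← X.str.s_onA, hb]) v := by
  classical
  have := Fintype.ofFinite {b : X.quiv.A // X.str.onA b = a}
  rw [lin_map_apply, Finset.sum_eq_single ⟨b, hb⟩, if_pos rfl]
  · intro b' _ h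
    refine if_neg fun h2 => h (Subtype.ext (hX _ _ h2 (b'.2.trans hb.symm)))
  · intro h; exact (h (Finset.mem_univ _)).elim

theorem coord_map_of_ne (X : OverQ Q) {a : Q.A} (v : (linearization K X).sp (Q.s a))
    (z : X.quiv.V) (hz : X.str.onV z = Q.t a) (h : ∀ b, X.str.onA b = a → X.quiv.t b ≠ z) :
    coord X z hz ((linearization K X).map a v) = 0 := by
  classical
  have := Fintype.ofFinite {b : X.quiv.A // X.str.onA b = a}
  rw [lin_map_apply]
  exact Finset.sum_eq_zero fun b _ => if_neg (h b.1 b.2)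

theorem map_bas {X : OverQ Q} (hX : X.OutInj) {a : Q.A} (b : X.quiv.A) (hb : X.str.onA b = a) :
    (linearization K X).map a (bas X (X.quiv.s b) (by rw [← X.str.s_onA, hb])) =
      bas X (X.quiv.t b) (by rw [← X.str.t_onA, hb]) := by
  classical
  have := Fintype.ofFinite {b : X.quiv.A // X.str.onA b = a}
  refine lin_ext fun z hz => ?_
  rw [lin_map_apply, Finset.sum_eq_single ⟨b, hb⟩]
  · split_ifs with h
    · subst h
      rw [coord_bas_self, coord_bas_self]
    · rw [coord_bas_of_ne _ _ _ (Ne.symm h)]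
  · intro b' _ h
    split_ifs
    · refine coord_bas_of_ne _ _ _ fun h2 => h (Subtype.ext (hX _ _ h2 (b'.2.trans hb.symm)))
    · rfl
  · intro h; exact (h (Finset.mem_univ _)).elim

/-! ### Support and dimensions of a linearization -/

theorem bas_ne_zero (X : OverQ Q) {x : Q.V} (y : X.quiv.V) (h : X.str.onV y = x) :
    (bas X y h : (linearization K X).sp x) ≠ 0 := by
  intro e
  have := coord_bas_self (K := K) X y h
  rw [e, map_zero] at this
  exact zero_ne_one this

/-- Out-injectivity excludes cancellation: an arrow with a lift sends some basis vector to a basis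
vector, so its map is nonzero over every field. -/
theorem support_linearization {X : OverQ Q} (hX : X.OutInj) :
    (linearization K X).support = X.image := by
  ext x
  · constructor
    · intro h
      by_contra h2
      have h : Nontrivial ((linearization K X).sp x) := h
      obtain ⟨v, w, hvw⟩ := h
      exact hvw (lin_ext fun y hy => (h2 ⟨y, hy⟩).elim)
    · rintro ⟨y, hy⟩
      exact ⟨bas X y hy, 0, bas_ne_zero X y hy⟩
  · constructor
    · intro h
      by_contra h2
      refine h (LinearMap.ext fun v => lin_ext fun y hy => ?_)
      rw [coord_map_of_ne X v y hy fun b hb => (h2 ⟨b, hb⟩).elim]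
      rw [LinearMap.zero_apply, map_zero]
    · rintro ⟨b, hb⟩ h
      have := map_bas (K := K) hX b hb
      rw [h, LinearMap.zero_apply] at this
      exact bas_ne_zero _ _ _ this.symm

theorem finrank_linearization (X : OverQ Q) (x : Q.V) :
    Module.finrank K ((linearization K X).sp x) = Nat.card {y : X.quiv.V // X.str.onV y = x} := by
  have := Fintype.ofFinite {y : X.quiv.V // X.str.onV y = x}
  rw [Nat.card_eq_fintype_card, (linEquiv X x).finrank_eq, Module.finrank_fintype_fun_eq_card]

theorem Rep.Iso.support_eq {V W : Rep K Q} (e : Rep.Iso V W) : V.support = W.support := by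
  have key : ∀ {V W : Rep K Q} (e : Rep.Iso V W) (a : Q.A), V.map a ≠ 0 → W.map a ≠ 0 := by
    intro V W e a h h2
    refine h (LinearMap.ext fun v => ?_)
    have := e.comm a v
    rw [h2, LinearMap.zero_apply] at this
    simpa using this
  ext x
  · exact (e.app x).toEquiv.nontrivial_congr
  · exact ⟨key e x, key e.symm x⟩

/-- The fibers of two quivers over `Q` with isomorphic linearizations have the same size. -/
theorem card_fiber_eq {X Y : OverQ Q} (e : Rep.Iso (linearization K X) (linearization K Y))
    (x : Q.V) : Nat.card {y : X.quiv.V // X.str.onV y = x} =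
      Nat.card {y : Y.quiv.V // Y.str.onV y = x} := by
  rw [← finrank_linearization (K := K), ← finrank_linearization (K := K)]
  exact (e.app x).finrank_eq

theorem subsingleton_fiber {X Y : OverQ Q} (e : Rep.Iso (linearization K X) (linearization K Y))
    {x : Q.V} (h : ∀ y1 y2, Y.str.onV y1 = x → Y.str.onV y2 = x → y1 = y2) :
    ∀ y1 y2, X.str.onV y1 = x → X.str.onV y2 = x → y1 = y2 := by
  have h1 : Subsingleton {y : Y.quiv.V // Y.str.onV y = x} :=
    ⟨fun y z => Subtype.ext (h _ _ y.2 z.2)⟩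
  rw [← Finite.card_le_one_iff_subsingleton, ← card_fiber_eq e,
    Finite.card_le_one_iff_subsingleton] at h1
  exact fun y z hy hz => congrArg Subtype.val (h1.elim ⟨y, hy⟩ ⟨z, hz⟩)

theorem injective_onV_of_iso {X Y : OverQ Q}
    (e : Rep.Iso (linearization K X) (linearization K Y)) (h : Function.Injective Y.str.onV) :
    Function.Injective X.str.onV := fun y z hyz =>
  subsingleton_fiber e (fun _ _ h1 h2 => h (h1.trans h2.symm)) y z hyz rfl

/-- Objects of the PIE category with isomorphic linearizations are isomorphic. -/
theorem OverQ.PIELike.nonempty_iso [Q.IsAcyclic] {X Y : OverQ Q} (hX : X.PIELike) (hY : Y.PIELike)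
    (e : Rep.Iso (linearization K X) (linearization K Y)) : Nonempty (X ≅ Y) := by
  have h : X.image = Y.image := by
    rw [← support_linearization (K := K) hX.outInj, e.support_eq, support_linearization hY.outInj]
  -- The sink of an I-like `Y` is alone in its fiber. By equality of dimensions the fiber of `X`
  -- there is trivial too, and `PLike.injective_onV` spreads this to all fibers.
  have inj : ∀ {X Y : OverQ Q}, X.PLike → Y.ILike → X.image = Y.image →
      Rep.Iso (linearization K X) (linearization K Y) → Function.Injective X.str.onV := by
    intro X Y hX hY h e
    obtain ⟨q, hq⟩ := OverQ.exists_root (X := Y.op) hY.op.connected hY.op.inUnique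
    refine hX.injective_onV h (q := q) (fun y => ?_) (subsingleton_fiber e fun y1 y2 h1 h2 => ?_)
    · have := Relation.reflTransGen_swap.2 (hq y)
      exact Relation.ReflTransGen.mono (fun _ _ h => FinQuiver.op_adj.1 h) _ _ this
    · exact (eq_root (X := Y.op) hq h1).trans (eq_root (X := Y.op) hq h2).symm
  -- With trivial fibers both objects are E-like. Otherwise E is excluded, and so are mixed kinds by
  -- `inj`, so both are P-like or both are I-like.
  by_cases hV : Function.Injective X.str.onV
  · exact (hX.eLike hV).nonempty_iso (hY.eLike (injective_onV_of_iso e.symm hV)) h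
  · have hV2 : ¬ Function.Injective Y.str.onV := fun h => hV (injective_onV_of_iso e h)
    rcases hX with hX | hX | hX
    · rcases hY with hY | hY | hY
      · exact hX.nonempty_iso hY h
      · exact (hV (inj hX hY h e)).elim
      · exact (hV2 hY.injV).elim
    · rcases hY with hY | hY | hY
      · exact (hV2 (inj hY hX h.symm e.symm)).elim
      · exact hX.nonempty_iso hY h
      · exact (hV2 hY.injV).elim
    · exact (hV hX.injV).elim

/-! ### Indecomposability -/

/-- A nonzero representation with only scalar endomorphisms is indecomposable. -/
theorem isIndecomposable_of_scalar {V : Rep K Q} (h0 : ¬ V.IsZero)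
    (h : ∀ p : Rep.Hom V V, ∃ c : K, ∀ x v, p.app x v = c • v) : V.IsIndecomposable := by
  refine ⟨h0, fun A B ⟨e⟩ => ?_⟩
  -- The projection onto `A`. The scalar `c` acts as the identity on `A` and as zero on `B`, so one
  -- of them vanishes.
  let p : Rep.Hom V V :=
    { app := fun x => (e.app x).symm.toLinearMap ∘ₗ LinearMap.inl K (A.sp x) (B.sp x) ∘ₗ
        LinearMap.fst K (A.sp x) (B.sp x) ∘ₗ (e.app x).toLinearMap
      comm := fun a v => by
        simp only [LinearMap.comp_apply, LinearEquiv.coe_coe, LinearMap.fst_apply,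
          LinearMap.inl_apply]
        rw [LinearEquiv.symm_apply_eq, e.comm, e.comm, LinearEquiv.apply_symm_apply]
        simp }
  have hp : ∀ x v, e.app x (p.app x v) = ((e.app x v).1, 0) := fun x v =>
    LinearEquiv.apply_symm_apply _ _
  obtain ⟨c, hc⟩ := h p
  have h1 : ∀ x (v : A.sp x), v = c • v := by
    intro x v
    have := hp x ((e.app x).symm (v, 0))
    rw [hc, map_smul, LinearEquiv.apply_symm_apply] at this
    exact (congrArg Prod.fst this).symm
  have h2 : ∀ x (v : B.sp x), c • v = 0 := by
    intro x v
    have := hp x ((e.app x).symm (0, v))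
    rw [hc, map_smul, LinearEquiv.apply_symm_apply] at this
    exact congrArg Prod.snd this
  by_cases hc0 : c = 0
  · left
    intro x
    refine ⟨fun v w => ?_⟩
    rw [h1 x v, h1 x w, hc0, zero_smul, zero_smul]
  · right
    intro x
    refine ⟨fun v w => ?_⟩
    rw [(smul_eq_zero.1 (h2 x v)).resolve_left hc0, (smul_eq_zero.1 (h2 x w)).resolve_left hc0]

theorem linearization_not_isZero {X : OverQ Q} (h : X.quiv.IsConnected) :
    ¬ (linearization K X).IsZero := by
  intro h0
  obtain ⟨r⟩ := h.1
  have := h0 (X.str.onV r)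
  exact bas_ne_zero (K := K) X r rfl (Subsingleton.elim _ _)

/-- The basis vector of the root generates the representation and spans its space, so an
endomorphism is the scalar by which it multiplies that vector. -/
theorem OverQ.PLike.isIndecomposable [Q.IsAcyclic] {X : OverQ Q} (hX : X.PLike) :
    (linearization K X).IsIndecomposable := by
  refine isIndecomposable_of_scalar (linearization_not_isZero hX.connected) fun p => ?_
  obtain ⟨r, hr⟩ := OverQ.exists_root hX.connected hX.inUnique
  let c : K := coord X r rfl (p.app _ (bas X r rfl))
  have key : ∀ y x (hy : X.str.onV y = x), p.app x (bas X y hy) = c • bas X y hy := by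
    refine OverQ.tree_induction hr ?_ ?_
    · rintro _ rfl
      refine lin_ext fun z hz => ?_
      obtain rfl := eq_root hr hz
      rw [map_smul, coord_bas_self, smul_eq_mul, mul_one]
    · intro b ih x hy
      obtain rfl : Q.t (X.str.onA b) = x := by rw [X.str.t_onA, hy]
      rw [← map_bas hX.outInj b rfl, p.comm, ih, map_smul]
  refine ⟨c, fun x v => ?_⟩
  have : p.app x = c • LinearMap.id := lin_hom_ext fun y hy => key y x hy
  rw [this, LinearMap.smul_apply, LinearMap.id_apply]

/-- Dual to the P case: the space at the sink is a line, and every coordinate is obtained from the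
coordinate there by moving along arrows. -/
theorem OverQ.ILike.isIndecomposable [Q.IsAcyclic] {X : OverQ Q} (hX : X.ILike) :
    (linearization K X).IsIndecomposable := by
  refine isIndecomposable_of_scalar (linearization_not_isZero hX.connected) fun p => ?_
  obtain ⟨r, hr⟩ := OverQ.exists_root (X := X.op) hX.op.connected hX.op.inUnique
  let c : K := coord X r rfl (p.app _ (bas X r rfl))
  have key : ∀ y x (hy : X.str.onV y = x) v, coord X y hy (p.app x v) = c • coord X y hy v := by
    refine OverQ.tree_induction hr ?_ ?_
    · rintro _ rfl v
      have hv : v = coord X r rfl v • bas X r rfl := by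
        refine lin_ext fun z hz => ?_
        obtain rfl := eq_root (X := X.op) hr hz
        rw [map_smul, coord_bas_self, smul_eq_mul, mul_one]
      conv_lhs => rw [hv]
      rw [map_smul, map_smul, smul_eq_mul, smul_eq_mul, mul_comm]
    · intro b ih x hy v
      change X.quiv.A at b
      change X.str.onV (X.quiv.s b) = x at hy
      obtain rfl : Q.s (X.str.onA b) = x := by rw [X.str.s_onA, hy]
      refine (coord_map_target hX.inInj b rfl _).symm.trans ?_
      rw [← p.comm]
      refine (ih _ _ _).trans ?_
      congr 1
      exact coord_map_target hX.inInj b rfl v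
  exact ⟨c, fun x v => lin_ext fun y hy => by rw [key, map_smul]⟩

/-- Each space has dimension at most one, so an endomorphism is a scalar at each vertex; arrows act
as isomorphisms between lines and force these scalars to agree. -/
theorem OverQ.ELike.isIndecomposable {X : OverQ Q} (hX : X.ELike) :
    (linearization K X).IsIndecomposable := by
  refine isIndecomposable_of_scalar (linearization_not_isZero hX.connected) fun p => ?_
  obtain ⟨r⟩ := hX.connected.1
  let d : X.quiv.V → K := fun y => coord X y rfl (p.app _ (bas X y rfl))
  have hd : ∀ y x (hy : X.str.onV y = x), p.app x (bas X y hy) = d y • bas X y hy := by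
    rintro y _ rfl
    refine lin_ext fun z hz => ?_
    obtain rfl := hX.injV hz
    rw [map_smul, coord_bas_self, smul_eq_mul, mul_one]
  have key : ∀ y, d y = d r := by
    refine hX.connected.induction rfl fun b => ?_
    have h1 := hd (X.quiv.t b) _ (X.str.t_onA b).symm
    rw [← map_bas hX.outInj b rfl, p.comm, hd, map_smul, map_bas hX.outInj b rfl] at h1
    rw [smul_left_injective K (bas_ne_zero X _ _) h1]
  refine ⟨d r, fun x v => ?_⟩
  have : p.app x = d r • LinearMap.id := lin_hom_ext fun y hy => by
    rw [hd, key, LinearMap.smul_apply, LinearMap.id_apply]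
  rw [this, LinearMap.smul_apply, LinearMap.id_apply]

theorem OverQ.PIELike.isIndecomposable [Q.IsAcyclic] {X : OverQ Q} (hX : X.PIELike) :
    (linearization K X).IsIndecomposable :=
  hX.elim OverQ.PLike.isIndecomposable fun h =>
    h.elim OverQ.ILike.isIndecomposable OverQ.ELike.isIndecomposable

/-! ### Subprojective, subinjective and idempotent linearizations -/

/-- A representation freely generated along a rooted tree is projective. -/
theorem isProjective_of_tree [Q.IsAcyclic] {X : OverQ Q} (hX : X.InUnique) {r : X.quiv.V}
    (hr : ∀ y, Relation.ReflTransGen X.quiv.Adj r y)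
    (lift : ∀ y a, X.str.onV y = Q.s a → ∃ b, X.quiv.s b = y ∧ X.str.onA b = a)
    {V : Rep K Q} (e : ∀ x y, X.str.onV y = x → V.sp x)
    (hom_ext : ∀ (x) (W : Type u) [AddCommGroup W] [Module K W] (f g : V.sp x →ₗ[K] W),
      (∀ y h, f (e x y h) = g (e x y h)) → f = g)
    (hom_exists : ∀ (x) (W : Type u) [AddCommGroup W] [Module K W]
      (c : ∀ y, X.str.onV y = x → W), ∃ f : V.sp x →ₗ[K] W, ∀ y h, f (e x y h) = c y h)
    (map_e : ∀ b, V.map (X.str.onA b) (e _ (X.quiv.s b) (X.str.s_onA b).symm) =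
      e _ (X.quiv.t b) (X.str.t_onA b).symm) : V.IsProjective := by
  intro A B g f hg
  -- The root's generator may be lifted freely; its lift is then propagated along the tree. Letting
  -- the section depend on every `x` equal to the vertex below `y` keeps transports out of the later
  -- statements.
  obtain ⟨w, hw⟩ := hg (X.str.onV r) (f.app _ (e _ r rfl))
  obtain ⟨c, hc1, hc2⟩ := OverQ.exists_section hX hr
    (N := fun y => ∀ x, X.str.onV y = x → A.sp x) (fun x hx => hx ▸ w)
    (fun b ih x hx => (X.str.t_onA b).trans hx ▸ A.map (X.str.onA b) (ih _ (X.str.s_onA b).symm))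
  have hc3 : ∀ b, c (X.quiv.t b) _ (X.str.t_onA b).symm =
      A.map (X.str.onA b) (c (X.quiv.s b) _ (X.str.s_onA b).symm) := fun b => by rw [hc2]
  have hgc : ∀ y x hx, g.app x (c y x hx) = f.app x (e x y hx) := by
    refine OverQ.tree_induction hr ?_ ?_
    · rintro _ rfl
      rw [hc1]
      exact hw
    · intro b ih x hx
      obtain rfl : Q.t (X.str.onA b) = x := (X.str.t_onA b).trans hx
      rw [hc3, g.comm, ih, ← f.comm, map_e]
  choose h hh using fun x => hom_exists x (A.sp x) (c · x)
  refine ⟨⟨h, fun a => LinearMap.congr_fun (f := h (Q.t a) ∘ₗ V.map a) (g := A.map a ∘ₗ h (Q.s a))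
    (hom_ext _ _ _ _ fun y hy => ?_)⟩, fun x => LinearMap.congr_fun (f := g.app x ∘ₗ h x)
      (g := f.app x) (hom_ext _ _ _ _ fun y hy => ?_)⟩
  · obtain ⟨b, rfl, rfl⟩ := lift y a hy
    rw [LinearMap.comp_apply, LinearMap.comp_apply, map_e, hh, hh, hc3]
  · rw [LinearMap.comp_apply, hh, hgc]

/-- A representation cofreely generated along a tree leading to a sink is injective. -/
theorem isInjective_of_tree [Q.IsAcyclic] {X : OverQ Q} (hX : X.OutUnique) {r : X.quiv.V}
    (hr : ∀ y, Relation.ReflTransGen X.op.quiv.Adj r y)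
    (lift : ∀ y a, X.str.onV y = Q.t a → ∃ b, X.quiv.t b = y ∧ X.str.onA b = a)
    {V : Rep K Q} (e : ∀ x y, X.str.onV y = x → (V.sp x →ₗ[K] K))
    (ext : ∀ (x) (v w : V.sp x), (∀ y h, e x y h v = e x y h w) → v = w)
    (hom_exists : ∀ (x) (W : Type u) [AddCommGroup W] [Module K W]
      (c : ∀ y, X.str.onV y = x → (W →ₗ[K] K)),
      ∃ f : W →ₗ[K] V.sp x, ∀ y h v, e x y h (f v) = c y h v)
    (e_map : ∀ b v, e _ (X.quiv.t b) (X.str.t_onA b).symm (V.map (X.str.onA b) v) =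
      e _ (X.quiv.s b) (X.str.s_onA b).symm v) : V.IsInjective := by
  intro A B g f hg
  -- Over a field an injection has a linear retraction, so the coordinate functional at the sink
  -- extends to `B`.
  obtain ⟨w, hw⟩ : ∃ w : B.sp (X.str.onV r) →ₗ[K] K,
      ∀ v, w (g.app _ v) = e _ r rfl (f.app _ v) := by
    obtain ⟨k, hk⟩ := (g.app (X.str.onV r)).exists_leftInverse_of_injective
      (LinearMap.ker_eq_bot.2 (hg _))
    refine ⟨(e _ r rfl ∘ₗ f.app _) ∘ₗ k, fun v => ?_⟩
    have := LinearMap.congr_fun hk v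
    rw [LinearMap.comp_apply, LinearMap.id_apply] at this
    rw [LinearMap.comp_apply, this, LinearMap.comp_apply]
  obtain ⟨c, hc1, hc2⟩ := OverQ.exists_section (X := X.op) hX hr
    (N := fun y => ∀ x, X.str.onV y = x → (B.sp x →ₗ[K] K)) (fun x hx => hx ▸ w)
    (fun (b : X.quiv.A) ih x hx => (X.str.s_onA b).trans hx ▸
      ((ih (Q.t (X.str.onA b)) (X.str.t_onA b).symm) ∘ₗ B.map (X.str.onA b)))
  have hc3 : ∀ (b : X.quiv.A) v, c (X.quiv.s b) _ (X.str.s_onA b).symm v =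
      c (X.quiv.t b) _ (X.str.t_onA b).symm (B.map (X.str.onA b) v) := fun b v => by
    have h : c (X.quiv.s b) = _ := hc2 b
    rw [h]
    rfl
  have hgc : ∀ y x hx v, c y x hx (g.app x v) = e x y hx (f.app x v) := by
    refine OverQ.tree_induction hr ?_ ?_
    · rintro _ rfl v
      rw [hc1]
      exact hw v
    · intro b ih x hx v
      change X.quiv.A at b
      change X.str.onV (X.quiv.s b) = x at hx
      obtain rfl : Q.s (X.str.onA b) = x := (X.str.s_onA b).trans hx
      refine (hc3 b _).trans ?_
      rw [← g.comm]
      refine (ih _ _ _).trans ?_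
      rw [f.comm]
      exact e_map b _
  choose h hh using fun x => hom_exists x (B.sp x) (c · x)
  refine ⟨⟨h, fun a v => ext _ _ _ fun y hy => ?_⟩, fun x v => ext _ _ _ fun y hy => ?_⟩
  · obtain ⟨b, rfl, rfl⟩ := lift y a hy
    rw [hh, e_map, hh]
    exact (hc3 b v).symm
  · rw [hh]
    exact hgc y x hy v

/-- A quiver over `Q`, viewed over the image of its structure map. -/
def OverQ.toImage (X : OverQ Q) : OverQ X.image.toFinQuiver where
  quiv := X.quiv
  str := ⟨fun y => ⟨X.str.onV y, y, rfl⟩, fun b => ⟨X.str.onA b, b, rfl⟩,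
    fun b => Subtype.ext (X.str.s_onA b), fun b => Subtype.ext (X.str.t_onA b)⟩

theorem OverQ.PLike.isSubprojective [Q.IsAcyclic] {X : OverQ Q} (hX : X.PLike) :
    (linearization K X).IsSubprojective := by
  unfold Rep.IsSubprojective
  rw [support_linearization hX.outInj]
  obtain ⟨r, hr⟩ := OverQ.exists_root hX.connected hX.inUnique
  refine isProjective_of_tree (X := X.toImage) hX.inUnique hr (fun y a h => ?_)
    (fun x y h => bas X y (congrArg Subtype.val h)) (fun x W _ _ f g h => ?_)
    (fun x W _ _ c => ?_) (fun b => map_bas hX.outInj b rfl)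
  · obtain ⟨b, hb, hb2⟩ := hX.outLift.2 y a.1 a.2 (congrArg Subtype.val h).symm
    exact ⟨b, hb, Subtype.ext hb2⟩
  · exact lin_hom_ext fun y hy => h y (Subtype.ext hy)
  · obtain ⟨f, hf⟩ := exists_linearMap (K := K) X (x := x.1) (fun y hy => c y (Subtype.ext hy))
    exact ⟨f, fun y h => hf y _⟩

theorem OverQ.ILike.isSubinjective [Q.IsAcyclic] {X : OverQ Q} (hX : X.ILike) :
    (linearization K X).IsSubinjective := by
  unfold Rep.IsSubinjective
  rw [support_linearization hX.outUnique.outInj]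
  obtain ⟨r, hr⟩ := OverQ.exists_root (X := X.op) hX.op.connected hX.op.inUnique
  refine isInjective_of_tree (X := X.toImage) hX.outUnique hr (fun y a h => ?_)
    (fun x y h => coord X y (congrArg Subtype.val h)) (fun x v w h => ?_)
    (fun x W _ _ c => ?_) (fun b => coord_map_target hX.inInj b rfl)
  · obtain ⟨b, hb, hb2⟩ := hX.inLift.2 y a.1 a.2 (congrArg Subtype.val h).symm
    exact ⟨b, hb, Subtype.ext hb2⟩
  · exact lin_ext fun y hy => h y (Subtype.ext hy)
  · obtain ⟨f, hf⟩ := exists_coord_eq (K := K) X (x := x.1) (fun y hy => c y (Subtype.ext hy))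
    exact ⟨f, fun y h => hf y _⟩

theorem OverQ.ELike.isIdempotentRep {X : OverQ Q} (hX : X.ELike) :
    (linearization K X).IsIdempotentRep := by
  unfold Rep.IsIdempotentRep
  rw [support_linearization hX.outInj]
  choose y hy using fun x : X.image.toFinQuiver.V => x.2
  refine ⟨⟨fun x => LinearEquiv.ofBijective (coord X (y x) (hy x)) ⟨fun v w h => ?_, fun c => ?_⟩,
    fun a v => ?_⟩⟩
  · refine lin_ext fun z hz => ?_
    obtain rfl : z = y x := hX.injV (hz.trans (hy x).symm)
    exact h
  · refine ⟨c • bas X (y x) (hy x), ?_⟩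
    rw [map_smul, coord_bas_self, smul_eq_mul, mul_one]
  · obtain ⟨_, b, rfl⟩ := a
    change coord X _ _ ((linearization K X).map (X.str.onA b) v) = coord X _ _ v
    refine (coord_congr X (X.str.t_onA b).symm _ ?_ _).trans
      ((coord_map_target hX.inInj b rfl v).trans (coord_congr X _ _ ?_ v).symm)
    · exact hX.injV ((hy _).trans (X.str.t_onA b))
    · exact hX.injV ((hy _).trans (X.str.s_onA b))

end Linearization

/-! ## Classes of linearizations in the representation ring -/

section RingClasses

variable {K : Type u} [Field K] {Q : FinQuiver.{u}}

theorem Rep.Iso.toRing_eq {V W : Rep K Q} (e : Rep.Iso V W) : V.toRing = W.toRing := by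
  have h : V.cls = W.cls := Quotient.sound ⟨e⟩
  rw [Rep.toRing, Rep.toRing, h]

theorem toRing_tensor (V W : Rep K Q) : (V.tensor W).toRing = V.toRing * W.toRing := by
  rw [Rep.toRing, Rep.toRing, Rep.toRing, ← map_mul, FreeAbelianGroup.of_mul_of]
  rfl

theorem toRing_one : (Rep.one K Q).toRing = 1 := rfl

theorem toRing_dsum (V W : Rep K Q) : (V.dsum W).toRing = V.toRing + W.toRing := by
  rw [Rep.toRing, Rep.toRing, Rep.toRing, ← map_add, Ideal.Quotient.eq, ← sub_sub]
  exact AddSubgroup.subset_closure ⟨V, W, rfl⟩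

/-- A zero representation is isomorphic to its own double, so its class equals twice itself. -/
theorem toRing_eq_zero {V : Rep K Q} (h : V.IsZero) : V.toRing = 0 := by
  have e : Rep.Iso V (V.dsum V) :=
    { app := fun x => LinearEquiv.ofBijective (LinearMap.inl K (V.sp x) (V.sp x))
        ⟨LinearMap.inl_injective, fun v => by
          have := h x
          exact ⟨0, Subsingleton.elim _ _⟩⟩
      comm := fun a v => by
        have := h (Q.t a)
        exact Subsingleton.elim _ _ }
  have := e.toRing_eq
  rw [toRing_dsum] at this
  simpa using this

/-- The pullback of coordinates along a morphism. -/
theorem exists_pull {X Z : OverQ Q} (hX : X.InInj) (hZ : Z.InInj) (f : X ⟶ Z)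
    (hf : ∀ y b', Z.quiv.t b' = f.hom.onV y → ∃ b, X.quiv.t b = y ∧ f.hom.onA b = b') :
    ∃ p : Rep.Hom (linearization K Z) (linearization K X), ∀ x y hy v,
      coord X y hy (p.app x v) = coord Z (f.hom.onV y) ((OverQ.hom_onV f y).trans hy) v := by
  choose p hp using fun x => exists_coord_eq (K := K) X (x := x) (M := (linearization K Z).sp x)
    (fun y hy => coord Z (f.hom.onV y) ((OverQ.hom_onV f y).trans hy))
  refine ⟨⟨p, fun a v => lin_ext fun y hy => ?_⟩, hp⟩
  rw [hp]
  -- If no arrow over `a` ends at `y`, then by `hf` none ends at its image either, and both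
  -- coordinates vanish.
  by_cases h : ∃ b, X.str.onA b = a ∧ X.quiv.t b = y
  · obtain ⟨b, rfl, rfl⟩ := h
    rw [coord_map_target hX b rfl, hp]
    refine (coord_congr Z (by rw [← Z.str.t_onA, OverQ.hom_onA]) _ (f.hom.t_onA b).symm _).trans
      ((coord_map_target hZ (f.hom.onA b) (OverQ.hom_onA f b) v).trans
        (coord_congr Z _ _ (f.hom.s_onA b).symm _).symm)
  · rw [coord_map_of_ne X _ y hy fun b hb hb2 => h ⟨b, hb, hb2⟩, coord_map_of_ne]
    intro b' hb' hb2
    obtain ⟨b, hb, rfl⟩ := hf y b' hb2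
    exact h ⟨b, (OverQ.hom_onA f b).symm.trans hb', hb⟩

/-- Isomorphic quivers over `Q` have isomorphic linearizations. -/
theorem nonempty_linearization_iso {X Z : OverQ Q} (hX : X.InInj) (hZ : Z.InInj) (e : X ≅ Z) :
    Nonempty (Rep.Iso (linearization K Z) (linearization K X)) := by
  have hV : ∀ v, e.inv.hom.onV (e.hom.hom.onV v) = v := fun v =>
    congrArg (fun f : X ⟶ X => f.hom.onV v) e.hom_inv_id
  have hV2 : ∀ v, e.hom.hom.onV (e.inv.hom.onV v) = v := fun v =>
    congrArg (fun f : Z ⟶ Z => f.hom.onV v) e.inv_hom_id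
  have hA : ∀ v, e.inv.hom.onA (e.hom.hom.onA v) = v := fun v =>
    congrArg (fun f : X ⟶ X => f.hom.onA v) e.hom_inv_id
  have hA2 : ∀ v, e.hom.hom.onA (e.inv.hom.onA v) = v := fun v =>
    congrArg (fun f : Z ⟶ Z => f.hom.onA v) e.inv_hom_id
  obtain ⟨p, hp⟩ := exists_pull (K := K) hX hZ e.hom fun y b h =>
    ⟨e.inv.hom.onA b, by rw [e.inv.hom.t_onA, h, hV], hA2 b⟩
  obtain ⟨q, hq⟩ := exists_pull (K := K) hZ hX e.inv fun y b h =>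
    ⟨e.hom.hom.onA b, by rw [e.hom.hom.t_onA, h, hV2], hA b⟩
  refine ⟨⟨fun x => LinearEquiv.ofBijective (p.app x)
    ⟨Function.LeftInverse.injective (g := q.app x) fun v => lin_ext fun y hy => ?_,
      Function.RightInverse.surjective (g := q.app x) fun v => lin_ext fun y hy => ?_⟩, p.comm⟩⟩
  · rw [hq, hp]
    exact coord_congr Z _ _ (hV2 y) v
  · rw [hp, hq]
    exact coord_congr X _ _ (hV y) v

/-- The linearization of a disjoint union of two quivers over `Q` is a direct sum. -/
theorem nonempty_linearization_iso_dsum {X Y Z : OverQ Q} (hX : X.InInj) (hY : Y.InInj)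
    (hZ : Z.InInj) (f : X ⟶ Z) (g : Y ⟶ Z) (hfV : Function.Injective f.hom.onV)
    (hgV : Function.Injective g.hom.onV) (hfg : ∀ y z, f.hom.onV y ≠ g.hom.onV z)
    (hV : ∀ z, (∃ y, f.hom.onV y = z) ∨ ∃ y, g.hom.onV y = z)
    (hA : ∀ z, (∃ y, f.hom.onA y = z) ∨ ∃ y, g.hom.onA y = z) :
    Nonempty (Rep.Iso (linearization K Z) ((linearization K X).dsum (linearization K Y))) := by
  obtain ⟨p, hp⟩ := exists_pull (K := K) hX hZ f fun y b' h => by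
    rcases hA b' with ⟨b, rfl⟩ | ⟨b, rfl⟩
    · exact ⟨b, hfV (by rw [← f.hom.t_onA, h]), rfl⟩
    · rw [g.hom.t_onA] at h
      exact (hfg _ _ h.symm).elim
  obtain ⟨q, hq⟩ := exists_pull (K := K) hY hZ g fun y b' h => by
    rcases hA b' with ⟨b, rfl⟩ | ⟨b, rfl⟩
    · rw [f.hom.t_onA] at h
      exact (hfg _ _ h).elim
    · exact ⟨b, hgV (by rw [← g.hom.t_onA, h]), rfl⟩
  refine ⟨⟨fun x => LinearEquiv.ofBijective ((p.app x).prod (q.app x)) ⟨?_, ?_⟩, ?_⟩⟩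
  · intro v w h
    have h1 : p.app x v = p.app x w := congrArg Prod.fst h
    have h2 : q.app x v = q.app x w := congrArg Prod.snd h
    refine lin_ext fun z hz => ?_
    rcases hV z with ⟨y, rfl⟩ | ⟨y, rfl⟩
    · have := congrArg (coord X y ((OverQ.hom_onV f y).symm.trans hz)) h1
      rwa [hp, hp] at this
    · have := congrArg (coord Y y ((OverQ.hom_onV g y).symm.trans hz)) h2
      rwa [hq, hq] at this
  · rintro ⟨v, w⟩
    have key : ∀ z (hz : Z.str.onV z = x), ∃ c : K,
        (∀ y hy, f.hom.onV y = z → c = coord X y hy v) ∧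
        (∀ y hy, g.hom.onV y = z → c = coord Y y hy w) := by
      intro z hz
      rcases hV z with ⟨y, rfl⟩ | ⟨y, rfl⟩
      · refine ⟨coord X y ((OverQ.hom_onV f y).symm.trans hz) v, fun y' hy' h => ?_,
          fun y' hy' h => (hfg _ _ h.symm).elim⟩
        exact coord_congr X _ _ (hfV h).symm v
      · refine ⟨coord Y y ((OverQ.hom_onV g y).symm.trans hz) w,
          fun y' hy' h => (hfg _ _ h).elim, fun y' hy' h => ?_⟩
        exact coord_congr Y _ _ (hgV h).symm w
    choose c hc1 hc2 using key
    -- A vector with prescribed coordinates, obtained as the value at `1` of a linear map from `K`.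
    obtain ⟨l, hl⟩ := exists_coord_eq (K := K) Z (x := x) (M := K)
      (fun z hz => c z hz • LinearMap.id)
    have hl' : ∀ z hz, coord Z z hz (l 1) = c z hz := fun z hz => by
      rw [hl, LinearMap.smul_apply, LinearMap.id_apply, smul_eq_mul, mul_one]
    refine ⟨l 1, Prod.ext (lin_ext fun y hy => ?_) (lin_ext fun y hy => ?_)⟩
    · exact ((hp _ _ _ _).trans (hl' _ _)).trans (hc1 _ _ y hy rfl)
    · exact ((hq _ _ _ _).trans (hl' _ _)).trans (hc2 _ _ y hy rfl)
  · exact fun a v => Prod.ext (p.comm a v) (q.comm a v)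

theorem OverQ.InInj.disjointUnion {n : ℕ} {w : Fin n → OverQ Q} (h : ∀ k, (w k).InInj) :
    (OverQ.disjointUnion w).InInj := by
  rintro ⟨k, a⟩ ⟨l, b⟩ h1 h2
  obtain rfl : k = l := congrArg Sigma.fst h1
  have h3 : (w k).quiv.t a = (w k).quiv.t b := by simpa [OverQ.disjointUnion] using h1
  rw [h k a b h3 h2]

theorem toRing_disjointUnion {n : ℕ} (w : Fin n → OverQ Q) (h : ∀ k, (w k).InInj) :
    (linearization K (OverQ.disjointUnion w)).toRing = ∑ k, (linearization K (w k)).toRing := by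
  induction n with
  | zero =>
    rw [Fin.sum_univ_zero]
    refine toRing_eq_zero fun x => ⟨fun v v' => lin_ext fun y => ?_⟩
    exact y.1.elim0
  | succ n ih =>
    rw [Fin.sum_univ_succ, ← ih (fun k => w k.succ) fun k => h _, ← toRing_dsum]
    let f : w 0 ⟶ OverQ.disjointUnion w :=
      ⟨⟨fun v => ⟨0, v⟩, fun a => ⟨0, a⟩, fun _ => rfl, fun _ => rfl⟩, rfl⟩
    let g : OverQ.disjointUnion (fun k => w k.succ) ⟶ OverQ.disjointUnion w :=
      ⟨⟨fun v => ⟨v.1.succ, v.2⟩, fun a => ⟨a.1.succ, a.2⟩, fun _ => rfl, fun _ => rfl⟩, rfl⟩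
    refine (nonempty_linearization_iso_dsum (K := K) (h 0)
      (OverQ.InInj.disjointUnion fun k => h k.succ) (OverQ.InInj.disjointUnion h) f g
      (fun v v' hv => sigma_mk_injective (β := fun k => (w k).quiv.V) (i := 0) hv) ?_
      (fun y z hyz => (Fin.succ_ne_zero z.1 (congrArg Sigma.fst hyz).symm).elim) ?_ ?_).elim
      fun e => e.toRing_eq
    · rintro ⟨k, v⟩ ⟨l, v'⟩ hv
      obtain rfl : k = l := Fin.succ_injective _ (congrArg Sigma.fst hv)
      have : v = v' := sigma_mk_injective (i := k.succ) hv
      rw [this]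
    · rintro ⟨k, v⟩
      cases k using Fin.cases with
      | zero => exact Or.inl ⟨v, rfl⟩
      | succ k => exact Or.inr ⟨⟨k, v⟩, rfl⟩
    · rintro ⟨k, v⟩
      cases k using Fin.cases with
      | zero => exact Or.inl ⟨v, rfl⟩
      | succ k => exact Or.inr ⟨⟨k, v⟩, rfl⟩

/-- The linearization of a fiber product is a tensor product. -/
theorem nonempty_linearization_iso_tensor {X Y : OverQ Q} (hX : X.InInj) (hY : Y.InInj) :
    Nonempty (Rep.Iso ((linearization K X).tensor (linearization K Y))
      (linearization K (X.fiberProd Y))) := by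
  have key : ∀ x, ∃ φ : ((linearization K X).sp x ⊗[K] (linearization K Y).sp x) ≃ₗ[K]
      (linearization K (X.fiberProd Y)).sp x, ∀ (p : (X.fiberProd Y).quiv.V)
        (hp : (X.fiberProd Y).str.onV p = x) v w,
      coord (X.fiberProd Y) p hp (φ (v ⊗ₜ w)) =
        coord X p.1.1 hp v * coord Y p.1.2 (p.2.symm.trans hp) w := by
    intro x
    let B1 := Module.Basis.ofEquivFun (linEquiv (K := K) X x)
    let B2 := Module.Basis.ofEquivFun (linEquiv (K := K) Y x)
    let e : {y // X.str.onV y = x} × {y // Y.str.onV y = x} ≃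
        {p // (X.fiberProd Y).str.onV p = x} :=
      { toFun := fun q => ⟨⟨(q.1.1, q.2.1), q.1.2.trans q.2.2.symm⟩, q.1.2⟩
        invFun := fun p => (⟨p.1.1.1, p.2⟩, ⟨p.1.1.2, p.1.2.symm.trans p.2⟩)
        left_inv := fun _ => rfl
        right_inv := fun _ => rfl }
    refine ⟨((B1.tensorProduct B2).reindex e).equivFun ≪≫ₗ (linEquiv (X.fiberProd Y) x).symm,
      fun p hp v w => ?_⟩
    rw [coord_apply, LinearEquiv.trans_apply, LinearEquiv.apply_symm_apply,
      Module.Basis.equivFun_apply, Module.Basis.repr_reindex_apply]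
    refine (Module.Basis.tensorProduct_repr_tmul_apply B1 B2 v w _ _).trans ?_
    rw [smul_eq_mul, mul_comm]
    rfl
  choose φ hφ using key
  refine ⟨⟨φ, fun a => LinearMap.congr_fun
    (f := (φ (Q.t a)).toLinearMap ∘ₗ TensorProduct.map ((linearization K X).map a)
      ((linearization K Y).map a))
    (g := (linearization K (X.fiberProd Y)).map a ∘ₗ (φ (Q.s a)).toLinearMap)
    (TensorProduct.ext' fun v w => lin_ext fun p hp => ?_)⟩⟩
  rw [LinearMap.comp_apply, LinearMap.comp_apply, TensorProduct.map_tmul, LinearEquiv.coe_coe,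
    LinearEquiv.coe_coe, hφ]
  -- If no arrow of the product over `a` ends at `p`, then some component of `p` is not the end of
  -- an arrow over `a`; its coordinate vanishes, and so does the product.
  by_cases h : ∃ b, (X.fiberProd Y).str.onA b = a ∧ (X.fiberProd Y).quiv.t b = p
  · obtain ⟨b, rfl, rfl⟩ := h
    rw [coord_map_target (hX.fiberProd hY) b rfl, hφ]
    exact congrArg₂ _ (coord_map_target hX b.1.1 rfl v) (coord_map_target hY b.1.2 b.2.symm w)
  · rw [coord_map_of_ne _ _ p hp fun b hb hb2 => h ⟨b, hb, hb2⟩]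
    by_cases h1 : ∃ b, X.str.onA b = a ∧ X.quiv.t b = p.1.1
    · have h2 : ¬ ∃ b, Y.str.onA b = a ∧ Y.quiv.t b = p.1.2 := by
        rintro ⟨b', hb', hb2'⟩
        obtain ⟨b, hb, hb2⟩ := h1
        exact h ⟨⟨(b, b'), hb.trans hb'.symm⟩, hb, Subtype.ext (Prod.ext hb2 hb2')⟩
      exact mul_eq_zero_of_right _ (coord_map_of_ne Y _ _ _ fun b hb hb2 => h2 ⟨b, hb, hb2⟩)
    · exact mul_eq_zero_of_left (coord_map_of_ne X _ _ _ fun b hb hb2 => h1 ⟨b, hb, hb2⟩) _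

theorem toRing_fiberProd {X Y : OverQ Q} (hX : X.InInj) (hY : Y.InInj) :
    (linearization K (X.fiberProd Y)).toRing =
      (linearization K X).toRing * (linearization K Y).toRing := by
  obtain ⟨e⟩ := nonempty_linearization_iso_tensor (K := K) hX hY
  rw [← toRing_tensor, e.toRing_eq]

theorem toRing_terminal : (linearization K (OverQ.terminal Q)).toRing = 1 := by
  rw [← toRing_one]
  have hT : (OverQ.terminal Q).InInj := fun _ _ _ h => h
  refine Rep.Iso.toRing_eq ⟨fun x => LinearEquiv.ofBijective
    (coord (OverQ.terminal Q) x rfl) ⟨fun v w h => ?_, fun c => ?_⟩, fun a v => ?_⟩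
  · refine lin_ext fun z hz => ?_
    obtain rfl : z = x := hz
    exact h
  · refine ⟨c • bas (OverQ.terminal Q) x rfl, ?_⟩
    rw [map_smul]
    exact (congrArg (c • ·) (coord_bas_self (OverQ.terminal Q) x rfl)).trans (mul_one c)
  · exact coord_map_target hT a rfl v

end RingClasses

/-! ## Möbius inversion in acyclic categories -/

section Moebius

universe v w

variable {C : Type w} [Category.{v} C]

theorem homMatrix_self (hC : IsAcyclicCategory C) (x : C) : homMatrix C x x = 1 := by
  have : Unique (x ⟶ x) := ⟨⟨𝟙 x⟩, hC.endo x⟩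
  rw [homMatrix, Nat.card_unique, Nat.cast_one]

/-- The marks of an element of the free abelian group on the objects: the numbers of morphisms
to it from the objects. -/
noncomputable def mark (z : C) : (C →₀ ℤ) →ₗ[ℤ] ℤ := 
  Finsupp.linearCombination ℤ fun x => homMatrix C z x

theorem mark_eq_sum [Fintype C] (z : C) (u : C →₀ ℤ) : mark z u = ∑ x, homMatrix C z x * u x := by
  rw [mark, Finsupp.linearCombination_apply, Finsupp.sum_fintype _ _ (by simp)]
  exact Finset.sum_congr rfl fun x _ => by rw [smul_eq_mul, mul_comm]

variable {R : Type*} [CommRing R] (L : (C →₀ ℤ) →ₗ[ℤ] R)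

/-- Bilinear extension from objects. Asking only for some `n` with the right image and the right
marks avoids defining a product on the free abelian group. -/
theorem exists_mul_of_exists_mul
    (hmul : ∀ x y : C, ∃ n : C →₀ ℤ, L n = L (Finsupp.single x 1) * L (Finsupp.single y 1) ∧
      ∀ z, mark z n = mark z (Finsupp.single x 1) * mark z (Finsupp.single y 1)) (u v : C →₀ ℤ) :
    ∃ n, L n = L u * L v ∧ ∀ z, mark z n = mark z u * mark z v := by
  induction u using Finsupp.induction_linear with
  | zero => exact ⟨0, by simp, by simp⟩
  | add u u' h h' =>
    obtain ⟨n, h1, h2⟩ := h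
    obtain ⟨n', h1', h2'⟩ := h'
    exact ⟨n + n', by rw [map_add, map_add, h1, h1', add_mul],
      fun z => by rw [map_add, map_add, h2, h2', add_mul]⟩
  | single x c =>
    induction v using Finsupp.induction_linear with
    | zero => exact ⟨0, by simp, by simp⟩
    | add u u' h h' =>
      obtain ⟨n, h1, h2⟩ := h
      obtain ⟨n', h1', h2'⟩ := h'
      exact ⟨n + n', by rw [map_add, map_add, h1, h1', mul_add],
        fun z => by rw [map_add, map_add, h2, h2', mul_add]⟩
    | single y d =>
      obtain ⟨n, h1, h2⟩ := hmul x y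
      have hs : ∀ (x : C) (c : ℤ), Finsupp.single x c = c • Finsupp.single x 1 := by simp
      refine ⟨(c * d) • n, ?_, fun z => ?_⟩
      · rw [hs x, hs y, map_smul, map_smul, map_smul, h1, smul_mul_smul_comm]
      · rw [hs x, hs y, map_smul, map_smul, map_smul, h2, smul_mul_smul_comm]

variable [Finite C]

/-- The number of objects strictly below an object. -/
noncomputable def height (x : C) : ℕ := Nat.card {z : C // z ≠ x ∧ Nonempty (z ⟶ x)}

/-- Composition with `f` carries what lies below `x` to what lies below `y`. The object `x` itself
makes the inclusion strict, as acyclicity rules out morphisms both ways between distinct objects. -/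
theorem height_lt (hC : IsAcyclicCategory C) {x y : C} (hxy : x ≠ y) (f : x ⟶ y) :
    height x < height y := by
  have anti : ∀ {x y : C}, (x ⟶ y) → (y ⟶ x) → x = y := fun {x y} f g =>
    (hC.iso x y f ⟨g, hC.endo _ _, hC.endo _ _⟩).1
  have h : {z : C | z ≠ x ∧ Nonempty (z ⟶ x)} ⊂ {z : C | z ≠ y ∧ Nonempty (z ⟶ y)} := by
    refine Set.ssubset_iff_exists.2 ⟨?_, x, ⟨hxy, ⟨f⟩⟩, fun h => h.1 rfl⟩
    rintro z ⟨hz, ⟨g⟩⟩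
    refine ⟨?_, ⟨g ≫ f⟩⟩
    rintro rfl
    exact hxy (anti f g)
  exact Set.ncard_lt_ncard h (Set.toFinite _)

theorem homMatrix_eq_zero (hC : IsAcyclicCategory C) {x y : C} (hxy : x ≠ y)
    (h : height y ≤ height x) : homMatrix C x y = 0 := by
  have : IsEmpty (x ⟶ y) := ⟨fun f => absurd (height_lt hC hxy f) h.not_gt⟩
  rw [homMatrix, Nat.card_of_isEmpty, Nat.cast_zero]

theorem blockTriangular_homMatrix (hC : IsAcyclicCategory C) :
    (homMatrix C).BlockTriangular height := fun _ _ h =>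
  homMatrix_eq_zero hC (fun e => by rw [e] at h; exact lt_irrefl _ h) h.le

variable [Fintype C] [DecidableEq C]

/-- The matrix is block triangular by height, and each diagonal block is the identity because
distinct objects of equal height have no morphisms between them. -/
theorem det_homMatrix (hC : IsAcyclicCategory C) : (homMatrix C).det = 1 := by
  rw [(blockTriangular_homMatrix hC).det]
  refine Finset.prod_eq_one fun k _ => ?_
  have : (homMatrix C).toSquareBlock height k = 1 := by
    ext x y
    rw [Matrix.toSquareBlock_def, Matrix.of_apply, Matrix.one_apply]
    split_ifs with h
    · rw [h, homMatrix_self hC]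
    · exact homMatrix_eq_zero hC (fun e => h (Subtype.ext e)) (by rw [x.2, y.2])
  rw [this, Matrix.det_one]

theorem mobius_eq_inv : mobius C = (homMatrix C)⁻¹ := by
  unfold mobius
  congr!

theorem homMatrix_mul_mobius (hC : IsAcyclicCategory C) : homMatrix C * mobius C = 1 := by
  rw [mobius_eq_inv]
  exact Matrix.mul_nonsing_inv _ (by rw [det_homMatrix hC]; exact isUnit_one)

theorem sum_homMatrix_mul_mobius (hC : IsAcyclicCategory C) (x y : C) :
    ∑ z, homMatrix C x z * mobius C z y = if x = y then 1 else 0 := by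
  rw [← Matrix.mul_apply, homMatrix_mul_mobius hC, Matrix.one_apply]

theorem mobius_self (hC : IsAcyclicCategory C) (x : C) : mobius C x x = 1 := by
  have hu : IsUnit (homMatrix C).det := by rw [det_homMatrix hC]; exact isUnit_one
  let := Matrix.invertibleOfIsUnitDet _ hu
  have ht : (mobius C).BlockTriangular height := by
    rw [mobius_eq_inv]
    exact Matrix.blockTriangular_inv_of_blockTriangular (blockTriangular_homMatrix hC)
  have h := sum_homMatrix_mul_mobius hC x x
  rw [if_pos rfl, Finset.sum_eq_single x, homMatrix_self hC, one_mul] at h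
  · exact h
  · intro z _ hz
    -- For `z ≠ x` one factor vanishes: the inverse is block triangular as well, so the Möbius
    -- factor is zero if `z` is higher, and otherwise there is no morphism from `x` to `z`.
    by_cases hlt : height x < height z
    · rw [ht hlt, mul_zero]
    · rw [homMatrix_eq_zero hC hz.symm (not_lt.1 hlt), zero_mul]
  · exact fun h => (h (Finset.mem_univ _)).elim

/-! ### Marks and orthogonal idempotents -/

theorem mark_delta (hC : IsAcyclicCategory C) (z x : C) :
    mark z (delta x) = if z = x then 1 else 0 := by
  rw [mark_eq_sum, ← sum_homMatrix_mul_mobius hC]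
  rfl

theorem mark_injective (hC : IsAcyclicCategory C) {u v : C →₀ ℤ}
    (h : ∀ z, mark z u = mark z v) : u = v := by
  refine DFunLike.coe_injective (Matrix.mulVec_injective_of_isUnit
    ((Matrix.isUnit_iff_isUnit_det (homMatrix C)).2 (by
      rw [det_homMatrix hC]; exact isUnit_one)) (funext fun z => ?_))
  have := h z
  rwa [mark_eq_sum, mark_eq_sum] at this

/-- The product is the image of an element whose marks are products of indicator functions. Since
marks separate elements, it is `delta x` or zero. -/
theorem delta_mul_delta (hC : IsAcyclicCategory C)
    (hmul : ∀ x y : C, ∃ n : C →₀ ℤ, L n = L (Finsupp.single x 1) * L (Finsupp.single y 1) ∧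
      ∀ z, mark z n = mark z (Finsupp.single x 1) * mark z (Finsupp.single y 1)) (x y : C) :
    L (delta x) * L (delta y) = if x = y then L (delta x) else 0 := by
  obtain ⟨n, h1, h2⟩ := exists_mul_of_exists_mul L hmul (delta x) (delta y)
  have : n = if x = y then delta x else 0 := mark_injective hC fun z => by
    rw [h2, mark_delta hC, mark_delta hC]
    split_ifs with h3 h4 h5 h5 h5 h5
    all_goals simp_all [mark_delta]
  rw [← h1, this]
  split_ifs <;> simp

theorem sum_delta (hC : IsAcyclicCategory C)
    (hone : ∃ n : C →₀ ℤ, L n = 1 ∧ ∀ z, mark z n = 1) : ∑ x, L (delta x) = 1 := by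
  obtain ⟨n, h1, h2⟩ := hone
  have : ∑ x, delta x = n := mark_injective hC fun z => by
    rw [map_sum, h2]
    simp [mark_delta hC]
  rw [← map_sum, this, h1]

end Moebius

/-- A complete family of orthogonal idempotents decomposes a ring. -/
theorem exists_ringEquiv_pi {ι R : Type*} [Fintype ι] [DecidableEq ι] [CommRing R] (e : ι → R)
    (hmul : ∀ x y, e x * e y = if x = y then e x else 0) (hone : ∑ x, e x = 1) :
    ∃ φ : R ≃+* ((x : ι) → (Ideal.span {e x} : Ideal R)), ∀ r x, (φ r x : R) = r * e x := by
  refine ⟨{ toFun := fun r x => ⟨r * e x, Ideal.mem_span_singleton'.2 ⟨r, rfl⟩⟩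
            invFun := fun v => ∑ x, (v x : R)
            left_inv := fun r => ?_
            right_inv := fun v => ?_
            map_mul' := fun r s => ?_
            map_add' := fun r s => ?_ }, fun r x => rfl⟩
  · change ∑ x, r * e x = r
    rw [← Finset.mul_sum, hone, mul_one]
  · funext x
    refine Subtype.ext ?_
    change (∑ y, (v y : R)) * e x = v x
    -- An element of the ideal of `e x` is a multiple of it, hence fixed by `e x` and killed by the
    -- other idempotents.
    rw [Finset.sum_mul, Finset.sum_eq_single x]
    · obtain ⟨a, ha⟩ := Ideal.mem_span_singleton'.1 (v x).2
      rw [← ha, mul_assoc, hmul, if_pos rfl]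
    · intro y _ hy
      obtain ⟨a, ha⟩ := Ideal.mem_span_singleton'.1 (v y).2
      rw [← ha, mul_assoc, hmul, if_neg hy, mul_zero]
    · exact fun h => (h (Finset.mem_univ _)).elim
  · funext x
    refine Subtype.ext ?_
    change r * s * e x = (r * e x) * (s * e x)
    rw [mul_mul_mul_comm, hmul, if_pos rfl]
  · funext x
    exact Subtype.ext (add_mul r s (e x))

/-! ## The PIE category -/

section PIECategory

variable {Q : FinQuiver.{u}} [Q.IsAcyclic]

theorem pieLike_obj (x : PIE Q) : ((PIE.incl Q).obj x).PIELike :=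
  OverQ.pieLike_of_isPIE (ObjectProperty.FullSubcategory.property _)

theorem exists_pie_iso {X : OverQ Q} (h : X.PIELike) :
    ∃ x : PIE Q, Nonempty ((PIE.incl Q).obj x ≅ X) := by
  obtain ⟨Y, hY, ⟨e⟩⟩ := h.exists_isPIE
  let y : ObjectProperty.FullSubcategory (C := OverQ Q) (IsPIE Q) := ⟨Y, hY⟩
  exact ⟨toSkeleton y, ⟨(ObjectProperty.ι (C := OverQ Q) (IsPIE Q)).mapIso
    (fromSkeletonToSkeletonIso y) ≪≫ e.symm⟩⟩

theorem pie_isAcyclicCategory : IsAcyclicCategory (PIE Q) := by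
  have endo : ∀ (x : PIE Q) (f : x ⟶ x), f = 𝟙 x := fun x f =>
    (PIE.incl Q).map_injective (((pieLike_obj x).endo _).trans ((PIE.incl Q).map_id x).symm)
  refine ⟨endo, fun x y f hf => ?_⟩
  have h : x = y := skeleton_skeletal _ ⟨asIso f⟩
  subst h
  exact ⟨rfl, endo x f⟩

theorem exists_pie_disjointUnion {X : OverQ Q} (h : ∀ k, (X.component k).PIELike) :
    ∃ (n : ℕ) (w : Fin n → PIE Q),
      Nonempty (X ≅ OverQ.disjointUnion fun k => (PIE.incl Q).obj (w k)) := by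
  obtain ⟨n, ⟨e⟩⟩ := Finite.exists_equiv_fin (Quotient X.compSetoid)
  choose w hw using fun k => exists_pie_iso (h (e.symm k))
  exact ⟨n, w, X.nonempty_iso_disjointUnion e.symm _ fun k => (hw k).some⟩

theorem card_pie_hom (x y : PIE Q) :
    Nat.card (x ⟶ y) = Nat.card ((PIE.incl Q).obj x ⟶ (PIE.incl Q).obj y) :=
  Nat.card_congr (Functor.FullyFaithful.ofFullyFaithful (PIE.incl Q)).homEquiv

variable (K : Type u) [Field K]

theorem mainHypotheses : MainHypotheses K (PIE.incl Q) where
  full := inferInstance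
  faithful := inferInstance
  acyclic := pie_isAcyclicCategory
  connected x := (pieLike_obj x).connected
  wrapping x := (pieLike_obj x).outInj.isWrapping
  fiberProd x y := exists_pie_disjointUnion fun k =>
    (pieLike_obj x).fiberProd_component (pieLike_obj y) k
  indecomposable x := (pieLike_obj x).isIndecomposable
  distinct x y hxy := by
    rintro ⟨e⟩
    obtain ⟨i⟩ := (pieLike_obj x).nonempty_iso (pieLike_obj y) e
    exact hxy (skeleton_skeletal _ ⟨(PIE.incl Q).preimageIso i⟩)

/-- A quiver over `Q` with components in the PIE category is represented in the free abelian
group on its objects. -/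
theorem exists_mark_eq_card {X : OverQ Q} (hX : X.InInj)
    (h : ∀ k, (X.component k).PIELike) : ∃ n : PIE Q →₀ ℤ,
      linMap K Q n = (linearization K X).toRing ∧
      ∀ z, mark z n = Nat.card ((PIE.incl Q).obj z ⟶ X) := by
  obtain ⟨m, w, ⟨e⟩⟩ := exists_pie_disjointUnion h
  have hw : ∀ k, ((PIE.incl Q).obj (w k)).InInj := fun k => (pieLike_obj (w k)).inInj
  refine ⟨∑ k, Finsupp.single (w k) 1, ?_, fun z => ?_⟩
  · obtain ⟨i⟩ := nonempty_linearization_iso (K := K) hX (OverQ.InInj.disjointUnion hw) e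
    rw [← i.toRing_eq, toRing_disjointUnion _ hw, map_sum]
    exact Finset.sum_congr rfl fun k _ => by
      rw [linMap, Finsupp.linearCombination_single, one_smul]
  · rw [Nat.card_congr ((Iso.refl ((PIE.incl Q).obj z)).homCongr e),
      OverQ.card_hom_disjointUnion _ (pieLike_obj z).connected, map_sum, Nat.cast_sum]
    exact Finset.sum_congr rfl fun k _ => by
      rw [mark, Finsupp.linearCombination_single, one_smul, homMatrix, card_pie_hom]

/-- The fiber product supplies `n`: its linearization is the tensor product, its marks are the
products of marks, and its components are again objects. -/
theorem exists_linMap_mul (x y : PIE Q) : ∃ n : PIE Q →₀ ℤ,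
    linMap K Q n = linMap K Q (Finsupp.single x 1) * linMap K Q (Finsupp.single y 1) ∧
      ∀ z, mark z n = mark z (Finsupp.single x 1) * mark z (Finsupp.single y 1) := by
  have hx := pieLike_obj x
  have hy := pieLike_obj y
  obtain ⟨n, h1, h2⟩ := exists_mark_eq_card K (hx.inInj.fiberProd hy.inInj)
    fun k => hx.fiberProd_component hy k
  refine ⟨n, ?_, fun z => ?_⟩
  · rw [h1, toRing_fiberProd hx.inInj hy.inInj, linMap, Finsupp.linearCombination_single,
      Finsupp.linearCombination_single, one_smul, one_smul]
  · rw [h2, OverQ.card_hom_fiberProd, mark, Finsupp.linearCombination_single,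
      Finsupp.linearCombination_single, one_smul, one_smul, homMatrix, homMatrix, card_pie_hom,
      card_pie_hom, Nat.cast_mul]

variable (Q) in
theorem exists_linMap_one : ∃ n : PIE Q →₀ ℤ, linMap K Q n = 1 ∧ ∀ z, mark z n = 1 := by
  obtain ⟨n, h1, h2⟩ := exists_mark_eq_card K (X := OverQ.terminal Q) (fun _ _ _ h => h)
    OverQ.terminal_component
  refine ⟨n, h1.trans toRing_terminal, fun z => ?_⟩
  rw [h2, OverQ.card_hom_terminal, Nat.cast_one]

end PIECategory

end QuiverRep

theorem mainTheorem4 (K : Type u) [Field K] (Q : QuiverRep.FinQuiver.{u}) [Q.IsAcyclic] :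
    -- the PIE category satisfies the hypotheses on a category of quivers over `Q`
    QuiverRep.MainHypotheses K (QuiverRep.PIE.incl Q) ∧
    -- the objects linearize to subprojective, subinjective and idempotent indecomposables
    (∀ (T : QuiverRep.Subquiver Q) (i : T.toFinQuiver.V), T.toFinQuiver.IsUniqueSource i →
      (QuiverRep.linearization K (QuiverRep.objP T i)).IsSubprojective ∧
      (QuiverRep.linearization K (QuiverRep.objP T i)).IsIndecomposable) ∧
    (∀ (T : QuiverRep.Subquiver Q) (i : T.toFinQuiver.V), T.toFinQuiver.IsUniqueSink i →
      (QuiverRep.linearization K (QuiverRep.objI T i)).IsSubinjective ∧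
      (QuiverRep.linearization K (QuiverRep.objI T i)).IsIndecomposable) ∧
    (∀ T : QuiverRep.Subquiver Q, T.toFinQuiver.IsConnected →
      (QuiverRep.linearization K (QuiverRep.objE T)).IsIdempotentRep ∧
      (QuiverRep.linearization K (QuiverRep.objE T)).IsIndecomposable) ∧
    -- the Hom matrix is invertible, with inverse the Möbius function
    (∀ x : QuiverRep.PIE Q, QuiverRep.mobius (QuiverRep.PIE Q) x x = 1) ∧
    (∀ x : QuiverRep.PIE Q, ∑ᶠ z : QuiverRep.PIE Q,
      (Nat.card (x ⟶ z) : ℤ) * QuiverRep.mobius (QuiverRep.PIE Q) z x = 1) ∧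
    (∀ x y : QuiverRep.PIE Q, x ≠ y → ∑ᶠ z : QuiverRep.PIE Q,
      (Nat.card (x ⟶ z) : ℤ) * QuiverRep.mobius (QuiverRep.PIE Q) z y = 0) ∧
    -- the elements `e_x` are idempotent, and `r ↦ (r e_x)_x` is an isomorphism of rings
    (∀ x : QuiverRep.PIE Q, IsIdempotentElem (QuiverRep.pieIdem K x)) ∧
    ∃ φ : QuiverRep.RepRing K Q ≃+*
        ((x : QuiverRep.PIE Q) → (Ideal.span {QuiverRep.pieIdem K x} :
          Ideal (QuiverRep.RepRing K Q))),
      ∀ r x, (φ r x : QuiverRep.RepRing K Q) = r * QuiverRep.pieIdem K x := by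
  classical
  have := Fintype.ofFinite (QuiverRep.PIE Q)
  have hC : QuiverRep.IsAcyclicCategory (QuiverRep.PIE Q) := QuiverRep.pie_isAcyclicCategory
  have hmul : ∀ x y : QuiverRep.PIE Q, QuiverRep.pieIdem K x * QuiverRep.pieIdem K y =
      if x = y then QuiverRep.pieIdem K x else 0 :=
    QuiverRep.delta_mul_delta _ hC (QuiverRep.exists_linMap_mul K)
  have hsum := QuiverRep.sum_homMatrix_mul_mobius hC
  refine ⟨QuiverRep.mainHypotheses K,
    fun T i _ => ⟨(QuiverRep.OverQ.objP_pLike T i).isSubprojective,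
      (QuiverRep.OverQ.objP_pLike T i).isIndecomposable⟩,
    fun T i _ => ⟨(QuiverRep.OverQ.objI_iLike T i).isSubinjective,
      (QuiverRep.OverQ.objI_iLike T i).isIndecomposable⟩,
    fun T h => ⟨(QuiverRep.OverQ.objE_eLike T h).isIdempotentRep,
      (QuiverRep.OverQ.objE_eLike T h).isIndecomposable⟩,
    QuiverRep.mobius_self hC, fun x => ?_, fun x y hxy => ?_, fun x => ?_, ?_⟩
  · rw [finsum_eq_sum_of_fintype]
    exact (hsum x x).trans (if_pos rfl)
  · rw [finsum_eq_sum_of_fintype]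
    exact (hsum x y).trans (if_neg hxy)
  · exact (hmul x x).trans (if_pos rfl)
  · exact QuiverRep.exists_ringEquiv_pi _ hmul
      (QuiverRep.sum_delta _ hC (QuiverRep.exists_linMap_one Q K))
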